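/- A \emph{path category} is a category $\mathcal{C}$ with two classes of maps, fibrations and weak equivalences (a map in both is an acyclic fibration), such that: (1) fibrations are closed under composition; (2) the pullback of a fibration along any map exists and is a fibration; (3) pullbacks of acyclic fibrations are acyclic fibrations; (4) weak equivalences satisfy 2-out-of-6; (5) isomorphisms are acyclic fibrations and every acyclic fibration has a section; (6) every object $B$ has a path object, i.e. a factorisation of the diagonal $B\to B\times B$ as a weak equivalence $r:B\to PB$ followed by a fibration $(s,t):PB\to B\times B$; (7) there is a terminal object $1$ and every map $X\to 1$ is a fibration. For an object $X$, let $\mathcal{C}(X)$ be the full subcategory of $\mathcal{C}/X$ on the fibrations with codomain $X$, with fibrations and weak equivalences as in $\mathcal{C}$; this is again a path category. A fibration $(p_1,p_2):R\to X\times X$ is a \emph{homotopy equivalence relation} if there are maps $\rho:X\to R$, $\sigma:R\to R$, $\tau:R\times_X R\to R$ with $p_1\rho=p_2\rho=1$; $p_1\sigma=p_2$, $p_2\sigma=p_1$; and $p_1\tau=p_1q_1$, $p_2\tau=p_2q_2$, where $R\times_X R$ is the pullback of $p_2$ and $p_1$ with projections $q_1,q_2$. The \emph{homotopy exact completion} $\mathrm{Hex}(\mathcal{C})$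 has as objects pairs $(X,R)$ with $R$ a homotopy equivalence relation on $X$; a morphism $(X,R)\to(Y,S)$ is an equivalence class of maps $f:X\to Y$ for which $f\times f$ lifts to a map $R\to S$, where $f,g:X\to Y$ are identified if $(f,g):X\to Y\times Y$ factors through $S$. For a path object $PX$ on $X$, which is a homotopy equivalence relation on $X$, put $i(X)=(X,PX)$. Let $(f:Y\to X,\ \tau:T\to Y\times_X Y)$ be an object of $\mathrm{Hex}(\mathcal{C}(X))$, and let $Y\times_X PX$ be the pullback of $f$ and $s$. Write $a\simeq_T b$, for maps $a,b:Z\to Y$ in $\mathcal{C}$, if $fa=fb$ and $(a,b):Z\to Y\times_X Y$ factors through $\tau$. A \emph{$T$-transport} is a map $\Gamma:Y\times_X PX\to Y$ such that $f\,\Gamma(y,\alpha)=t(\alpha)$ for all generalised elements $(y,\alpha)$ and $\Gamma(1_Y,rf)\simeq_T 1_Y$; it exists and is unique up to $\simeq_T$. The object $(f,T)$ is \emph{stable} if loops in $X$ act $T$-trivially through the $T$-transport $\Gamma$: for all $y:Z\to Y$ and $\alpha:Z\to PX$ with $s\alpha=t\alpha=fy$, one has $\Gamma(y,\alpha)\simeq_T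 y$. \textbf{Theorem.} Let $\mathcal{C}$ be a path category, $X$ an object of $\mathcal{C}$ and $PX$ a path object on $X$. Then $\mathrm{Hex}(\mathcal{C})/i(X)$ is equivalent to the full subcategory of $\mathrm{Hex}(\mathcal{C}(X))$ consisting of the stable objects. Moreover, the composite of this equivalence with the inclusion of the stable objects into $\mathrm{Hex}(\mathcal{C}(X))$ exhibits $\mathrm{Hex}(\mathcal{C})/i(X)$ as a reflective subcategory of $\mathrm{Hex}(\mathcal{C}(X))$ (it is fully faithful and has a left adjoint). -/

import Mathlib

open CategoryTheory Limits HomotopicalAlgebra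

universe v u

/-- Path categories (categories with path objects): categories with two classes of maps,
fibrations and weak equivalences, such that the axioms below hold.
A path object on `B` is a factorisation of the diagonal `B ⟶ B ⨯ B` as a weak equivalence
followed by a fibration, i.e. a `PathObject B` which satisfies `PathObject.IsGood`. -/
class PathCategory (C : Type u) [Category.{v} C] [CategoryWithFibrations C]
    [CategoryWithWeakEquivalences C] : Prop where
  /-- Fibrations are closed under composition. -/
  fibration_comp {X Y Z : C} (f : X ⟶ Y) (g : Y ⟶ Z) :
    Fibration f → Fibration g → Fibration (f ≫ g)
  /-- The pullback of a fibration along any map exists. -/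
  hasPullback {X Y A : C} (f : X ⟶ A) (g : Y ⟶ A) : Fibration f → HasPullback f g
  /-- Pullbacks of fibrations are fibrations. -/
  fibration_of_isPullback {W X Y A : C} {p : W ⟶ X} {q : W ⟶ Y} {f : X ⟶ A} {g : Y ⟶ A} :
    IsPullback p q f g → Fibration f → Fibration q
  /-- Pullbacks of acyclic fibrations are acyclic fibrations. -/
  weakEquivalence_of_isPullback {W X Y A : C} {p : W ⟶ X} {q : W ⟶ Y} {f : X ⟶ A} {g : Y ⟶ A} :
    IsPullback p q f g → Fibration f → WeakEquivalence f → WeakEquivalence q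
  /-- Weak equivalences satisfy 2-out-of-6. -/
  two_out_of_six {A B D E : C} (f : A ⟶ B) (g : B ⟶ D) (h : D ⟶ E) :
    WeakEquivalence (f ≫ g) → WeakEquivalence (g ≫ h) →
      WeakEquivalence f ∧ WeakEquivalence g ∧ WeakEquivalence h ∧ WeakEquivalence (f ≫ g ≫ h)
  /-- Isomorphisms are fibrations. -/
  fibration_of_isIso {X Y : C} (f : X ⟶ Y) : IsIso f → Fibration f
  /-- Isomorphisms are weak equivalences. -/
  weakEquivalence_of_isIso {X Y : C} (f : X ⟶ Y) : IsIso f → WeakEquivalence f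
  /-- Every acyclic fibration has a section. -/
  exists_section {X Y : C} (f : X ⟶ Y) :
    Fibration f → WeakEquivalence f → ∃ s : Y ⟶ X, s ≫ f = 𝟙 Y
  /-- Every object has a path object (its square exists by the other axioms). -/
  exists_pathObject (B : C) [HasBinaryProduct B B] : ∃ P : PathObject B, P.IsGood
  /-- There is a terminal object. -/
  hasTerminal : HasTerminal C
  /-- All maps to the terminal object are fibrations. -/
  fibration_from (X : C) : Fibration (terminal.from X)

namespace PathCategory

section Basic

variable {C : Type u} [Category.{v} C] [CategoryWithFibrations C]
  [CategoryWithWeakEquivalences C] [PathCategory C]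

attribute [instance] hasTerminal fibration_from

instance hasPullback_left {X Y A : C} (f : X ⟶ A) (g : Y ⟶ A) [hf : Fibration f] :
    HasPullback f g := hasPullback f g hf

instance hasPullback_right {X Y A : C} (f : X ⟶ A) (g : Y ⟶ A) [Fibration g] :
    HasPullback f g := hasPullback_symmetry g f

instance : (fibrations C).IsStableUnderComposition where
  comp_mem f g hf hg := (fibration_comp f g ⟨hf⟩ ⟨hg⟩).mem

instance : (fibrations C).IsStableUnderBaseChange where
  of_isPullback sq hg := (fibration_of_isPullback sq ⟨hg⟩).mem

instance : (trivialFibrations C).IsStableUnderBaseChange where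
  of_isPullback sq hg :=
    ⟨(fibration_of_isPullback sq ⟨hg.1⟩).mem,
      (weakEquivalence_of_isPullback sq ⟨hg.1⟩ ⟨hg.2⟩).mem⟩

instance {X Y : C} (f : X ⟶ Y) [h : IsIso f] : Fibration f := fibration_of_isIso f h

instance {X Y : C} (f : X ⟶ Y) [h : IsIso f] : WeakEquivalence f := weakEquivalence_of_isIso f h

instance : (weakEquivalences C).ContainsIdentities where
  id_mem X := (inferInstance : WeakEquivalence (𝟙 X)).mem

instance : (weakEquivalences C).HasTwoOutOfThreeProperty where
  comp_mem f g hf hg := by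
    have h := (two_out_of_six f (𝟙 _) g (by simpa using ⟨hf⟩) (by simpa using ⟨hg⟩)).2.2.2
    simpa using h.mem
  of_postcomp f g hg hfg :=
    (two_out_of_six f g (𝟙 _) ⟨hfg⟩ (by simpa using ⟨hg⟩)).1.mem
  of_precomp f g hf hfg :=
    (two_out_of_six (𝟙 _) f g (by simpa using ⟨hf⟩) ⟨hfg⟩).2.2.1.mem

instance : HasBinaryProducts C :=
  have : ∀ X Y : C, HasBinaryProduct X Y := fun X Y =>
    HasLimit.mk ⟨_, isBinaryProductOfIsTerminalIsPullback (pair X Y)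
      (BinaryFan.mk (pullback.fst (terminal.from X) (terminal.from Y))
        (pullback.snd (terminal.from X) (terminal.from Y)))
      terminalIsTerminal (terminal.from X) (terminal.from Y)
      (IsPullback.of_hasPullback (terminal.from X) (terminal.from Y)).isLimit⟩
  hasBinaryProducts_of_hasLimit_pair C

/-- Every map factors as a weak equivalence followed by a fibration. -/
theorem exists_factorization {Y X : C} (f : Y ⟶ X) :
    ∃ (Z : C) (w : Y ⟶ Z) (p : Z ⟶ X), w ≫ p = f ∧ WeakEquivalence w ∧ Fibration p := by
  obtain ⟨P, hP⟩ := exists_pathObject X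
  let w : Y ⟶ pullback f P.p₀ := pullback.lift (𝟙 Y) (f ≫ P.ι) (by simp)
  have hw : WeakEquivalence w := by
    have : WeakEquivalence (w ≫ pullback.fst f P.p₀) := by
      simp only [w, pullback.lift_fst]; infer_instance
    exact weakEquivalence_of_postcomp w (pullback.fst f P.p₀)
  let q : pullback f P.p₀ ⟶ Y ⨯ X :=
    prod.lift (pullback.fst f P.p₀) (pullback.snd f P.p₀ ≫ P.p₁)
  have q₁ : q ≫ prod.fst = pullback.fst f P.p₀ := prod.lift_fst _ _
  have q₂ : q ≫ prod.snd = pullback.snd f P.p₀ ≫ P.p₁ := prod.lift_snd _ _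
  have fac : pullback.snd f P.p₀ ≫ P.p = q ≫ prod.map f (𝟙 X) := by
    ext
    · simp [reassoc_of% q₁, pullback.condition]
    · simp [q₂]
  have sq : IsPullback (q ≫ prod.fst) (pullback.snd f P.p₀) f (P.p ≫ prod.fst) := by
    simpa [q₁] using IsPullback.of_hasPullback f P.p₀
  have hq : Fibration q :=
    fibration_of_isPullback
      (IsPullback.of_right sq fac.symm (IsPullback.of_prod_fst_with_id f X)).flip
      inferInstance
  have w₂ : w ≫ pullback.snd f P.p₀ = f ≫ P.ι := pullback.lift_snd _ _ _
  exact ⟨_, w, q ≫ prod.snd, by simp [q₂, reassoc_of% w₂], hw, inferInstance⟩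

/-- Lower fillers: in a commutative square with a weak equivalence `w` on the left and a fibration
`p` on the right there is a diagonal making the lower triangle commute. -/
theorem exists_lower_filler {D B E A : C} (g : D ⟶ E) (w : D ⟶ B) (p : E ⟶ A) (f : B ⟶ A)
    [WeakEquivalence w] [Fibration p] (comm : g ≫ p = w ≫ f) :
    ∃ l : B ⟶ E, l ≫ p = f := by
  obtain ⟨Z, i, q, hiq, _, _⟩ := exists_factorization (pullback.lift w g comm.symm)
  have : WeakEquivalence (i ≫ q ≫ pullback.fst f p) := by
    rw [reassoc_of% hiq, pullback.lift_fst]; infer_instance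
  have : WeakEquivalence (q ≫ pullback.fst f p) := weakEquivalence_of_precomp i _
  obtain ⟨a, ha⟩ := exists_section (q ≫ pullback.fst f p) inferInstance inferInstance
  refine ⟨a ≫ q ≫ pullback.snd f p, ?_⟩
  have h2 : (a ≫ q ≫ pullback.fst f p) ≫ f = f := by rw [ha, Category.id_comp]
  simpa [pullback.condition] using h2

end Basic

/-! ### The path category of fibrations over an object -/

section Slice

variable {C : Type u} [Category.{v} C] [CategoryWithFibrations C]

/-- The fibrations with codomain `A`, as objects of `C/A`. -/
def fibOver (A : C) : ObjectProperty (Over A) := fun f => Fibration f.hom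

/-- The category `C(A)`: the full subcategory of `C/A` on the fibrations with codomain `A`. -/
abbrev FibOver (A : C) := (fibOver A).FullSubcategory

variable {A : C}

instance : CategoryWithFibrations (FibOver A) where
  fibrations _ _ f := Fibration f.hom.left

instance [CategoryWithWeakEquivalences C] : CategoryWithWeakEquivalences (FibOver A) where
  weakEquivalences _ _ f := WeakEquivalence f.hom.left

theorem fibOver_fibration_iff {X Y : FibOver A} (f : X ⟶ Y) :
    Fibration f ↔ Fibration f.hom.left :=
  fibration_iff f

theorem fibOver_weakEquivalence_iff [CategoryWithWeakEquivalences C] {X Y : FibOver A}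
    (f : X ⟶ Y) : WeakEquivalence f ↔ WeakEquivalence f.hom.left :=
  weakEquivalence_iff f

/-- The object of `C(A)` given by a fibration. -/
def FibOver.mk {Y : C} (f : Y ⟶ A) (hf : Fibration f) : FibOver A := ⟨Over.mk f, hf⟩

/-- The morphism of `C(A)` given by a map over `A`. -/
def FibOver.homMk {X Y : FibOver A} (f : X.obj.left ⟶ Y.obj.left)
    (w : f ≫ Y.obj.hom = X.obj.hom) : X ⟶ Y := ObjectProperty.homMk (Over.homMk f w)

theorem FibOver.hom_ext {X Y : FibOver A} {f g : X ⟶ Y} (h : f.hom.left = g.hom.left) : f = g :=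
  ObjectProperty.hom_ext _ (Over.OverMorphism.ext h)

@[simp] theorem FibOver.comp_left {X Y Z : FibOver A} (f : X ⟶ Y) (g : Y ⟶ Z) :
    (f ≫ g).hom.left = f.hom.left ≫ g.hom.left := rfl

@[simp] theorem FibOver.id_left (X : FibOver A) :
    (InducedCategory.Hom.hom (𝟙 X)).left = 𝟙 X.obj.left := rfl

@[simp] theorem FibOver.homMk_left {X Y : FibOver A} (f : X.obj.left ⟶ Y.obj.left)
    (w : f ≫ Y.obj.hom = X.obj.hom) : (FibOver.homMk f w).hom.left = f := rfl

theorem FibOver.left_w {X Y : FibOver A} (f : X ⟶ Y) : f.hom.left ≫ Y.obj.hom = X.obj.hom :=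
  Over.w f.hom

variable [CategoryWithWeakEquivalences C] [PathCategory C]

theorem FibOver.exists_isPullback {X Y B : FibOver A} (f : X ⟶ B) (g : Y ⟶ B)
    (hf : Fibration f) :
    ∃ (W : FibOver A) (p : W ⟶ X) (q : W ⟶ Y), IsPullback p q f g ∧
      IsPullback p.hom.left q.hom.left f.hom.left g.hom.left := by
  have : Fibration f.hom.left := (fibOver_fibration_iff f).1 hf
  have hY : Fibration Y.obj.hom := Y.property
  have e : pullback.fst f.hom.left g.hom.left ≫ X.obj.hom =
      pullback.snd f.hom.left g.hom.left ≫ Y.obj.hom := by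
    rw [← FibOver.left_w f, ← FibOver.left_w g, ← Category.assoc, ← Category.assoc,
      pullback.condition]
  let W : FibOver A := FibOver.mk (pullback.snd f.hom.left g.hom.left ≫ Y.obj.hom) inferInstance
  let p : W ⟶ X := FibOver.homMk (pullback.fst f.hom.left g.hom.left) e
  let q : W ⟶ Y := FibOver.homMk (pullback.snd f.hom.left g.hom.left) rfl
  have w : p ≫ f = q ≫ g := FibOver.hom_ext (pullback.condition (f := f.hom.left)
    (g := g.hom.left))
  refine ⟨W, p, q, ⟨⟨w⟩, ⟨PullbackCone.IsLimit.mk w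
    (fun s => FibOver.homMk (pullback.lift s.fst.hom.left s.snd.hom.left
      (congrArg (fun k => k.hom.left) s.condition)) ?_) ?_ ?_ ?_⟩⟩,
    IsPullback.of_hasPullback f.hom.left g.hom.left⟩
  · exact (pullback.lift_snd_assoc s.fst.hom.left s.snd.hom.left
      (congrArg (fun k => k.hom.left) s.condition) Y.obj.hom).trans (FibOver.left_w s.snd)
  · exact fun s => FibOver.hom_ext (pullback.lift_fst s.fst.hom.left s.snd.hom.left _)
  · exact fun s => FibOver.hom_ext (pullback.lift_snd s.fst.hom.left s.snd.hom.left _)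
  · intro s m h₁ h₂
    apply FibOver.hom_ext
    have e₁ : m.hom.left ≫ pullback.fst f.hom.left g.hom.left = s.fst.hom.left :=
      congrArg (fun k => k.hom.left) h₁
    have e₂ : m.hom.left ≫ pullback.snd f.hom.left g.hom.left = s.snd.hom.left :=
      congrArg (fun k => k.hom.left) h₂
    exact pullback.hom_ext (e₁.trans (pullback.lift_fst _ _ _).symm)
      (e₂.trans (pullback.lift_snd _ _ _).symm)

theorem FibOver.isPullback_left {W X Y B : FibOver A} {p : W ⟶ X} {q : W ⟶ Y} {f : X ⟶ B}
    {g : Y ⟶ B} (h : IsPullback p q f g) (hf : Fibration f) :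
    IsPullback p.hom.left q.hom.left f.hom.left g.hom.left := by
  obtain ⟨W', p', q', h', hl⟩ := FibOver.exists_isPullback f g hf
  let e : W ≅ W' := h.isoIsPullback _ _ h'
  have e1 : e.hom ≫ p' = p := h.isoIsPullback_hom_fst _ _ h'
  have e2 : e.hom ≫ q' = q := h.isoIsPullback_hom_snd _ _ h'
  let el : W.obj.left ≅ W'.obj.left := ((fibOver A).ι ⋙ Over.forget A).mapIso e
  refine IsPullback.of_iso hl el.symm (Iso.refl _) (Iso.refl _) (Iso.refl _) ?_ ?_ (by simp)
    (by simp)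
  · exact (Category.comp_id _).trans
      (congrArg (fun k => k.hom.left) ((Iso.eq_inv_comp e).2 e1))
  · exact (Category.comp_id _).trans
      (congrArg (fun k => k.hom.left) ((Iso.eq_inv_comp e).2 e2))

/-- The terminal object of `C(A)` is the identity of `A`. -/
def FibOver.isTerminalId : IsTerminal (FibOver.mk (𝟙 A) inferInstance) :=
  IsTerminal.ofUniqueHom (fun X => FibOver.homMk X.obj.hom (Category.comp_id _))
    (fun _ m => FibOver.hom_ext
      ((Category.comp_id _).symm.trans (FibOver.left_w m)))

/-- `C(A)` is a path category. -/
instance : PathCategory (FibOver A) where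
  fibration_comp f g hf hg := by
    rw [fibOver_fibration_iff] at *
    exact fibration_comp _ _ hf hg
  hasPullback f g hf := by
    obtain ⟨W, p, q, h, -⟩ := FibOver.exists_isPullback f g hf
    exact h.hasPullback
  fibration_of_isPullback h hf := by
    have := FibOver.isPullback_left h hf
    rw [fibOver_fibration_iff] at *
    exact fibration_of_isPullback this hf
  weakEquivalence_of_isPullback h hf hw := by
    have := FibOver.isPullback_left h hf
    rw [fibOver_fibration_iff] at hf
    rw [fibOver_weakEquivalence_iff] at *
    exact weakEquivalence_of_isPullback this hf hw
  two_out_of_six f g h h₁ h₂ := by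
    simp only [fibOver_weakEquivalence_iff] at *
    exact two_out_of_six _ _ _ h₁ h₂
  fibration_of_isIso f hf := by
    rw [fibOver_fibration_iff]
    have : IsIso f.hom.left := inferInstanceAs (IsIso (((fibOver A).ι ⋙ Over.forget A).map f))
    infer_instance
  weakEquivalence_of_isIso f hf := by
    rw [fibOver_weakEquivalence_iff]
    have : IsIso f.hom.left := inferInstanceAs (IsIso (((fibOver A).ι ⋙ Over.forget A).map f))
    infer_instance
  exists_section {X Y} f hf hw := by
    rw [fibOver_fibration_iff] at hf
    rw [fibOver_weakEquivalence_iff] at hw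
    obtain ⟨s, hs⟩ := exists_section _ hf hw
    refine ⟨FibOver.homMk s ?_, FibOver.hom_ext hs⟩
    rw [← FibOver.left_w f, reassoc_of% hs]
  exists_pathObject B _ := by
    obtain ⟨Z, w, p, hwp, hw, hp⟩ := exists_factorization (diag B).hom.left
    have hBB : Fibration (B ⨯ B).obj.hom := (B ⨯ B).property
    let Z' : FibOver A := FibOver.mk (p ≫ (B ⨯ B).obj.hom) inferInstance
    let p' : Z' ⟶ B ⨯ B := FibOver.homMk p rfl
    let w' : B ⟶ Z' := FibOver.homMk w (by
      change w ≫ p ≫ _ = _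
      rw [reassoc_of% hwp]
      exact FibOver.left_w (diag B))
    have hwp' : w' ≫ p' = diag B := FibOver.hom_ext hwp
    let P : PathObject B :=
      { P := Z'
        p₀ := p' ≫ prod.fst
        p₁ := p' ≫ prod.snd
        ι := w'
        ι_p₀ := by rw [reassoc_of% hwp']; exact prod.lift_fst _ _
        ι_p₁ := by rw [reassoc_of% hwp']; exact prod.lift_snd _ _
        weakEquivalence_ι := (fibOver_weakEquivalence_iff w').2 hw }
    have hP : P.p = p' := by
      apply Limits.prod.hom_ext
      · simp [P]
      · simp [P]
    exact ⟨P, ⟨by rw [hP]; exact (fibOver_fibration_iff p').2 hp⟩⟩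
  hasTerminal := FibOver.isTerminalId.hasTerminal
  fibration_from X := by
    have : HasTerminal (FibOver A) := FibOver.isTerminalId.hasTerminal
    rw [fibOver_fibration_iff]
    let e : ⊤_ (FibOver A) ≅ FibOver.mk (𝟙 A) inferInstance :=
      terminalIsTerminal.uniqueUpToIso FibOver.isTerminalId
    have : IsIso (⊤_ (FibOver A)).obj.hom := by
      have h : e.hom.hom.left ≫ 𝟙 A = (⊤_ (FibOver A)).obj.hom := FibOver.left_w e.hom
      have h' : IsIso e.hom.hom.left :=
        inferInstanceAs (IsIso (((fibOver A).ι ⋙ Over.forget A).map e.hom))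
      have h'' : e.hom.hom.left = (⊤_ (FibOver A)).obj.hom := (Category.comp_id _).symm.trans h
      rw [← h'']
      exact h'
    have hX : Fibration X.obj.hom := X.property
    have h := FibOver.left_w (terminal.from X)
    rw [← IsIso.eq_comp_inv] at h
    rw [h]
    infer_instance

end Slice

/-! ### Homotopy equivalence relations and the homotopy exact completion -/

section Hex

variable {C : Type u} [Category.{v} C] [CategoryWithFibrations C]
  [CategoryWithWeakEquivalences C] [PathCategory C]

/-- A homotopy equivalence relation on `X`: a fibration `(p₁, p₂) : R ⟶ X ⨯ X` such that maps
witnessing reflexivity, symmetry and transitivity exist. In `trans`, the object `Q` is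
the pullback `R ×_X R`. -/
structure HomotopyEqRel (X : C) where
  /-- the total object `R` -/
  obj : C
  /-- the first projection -/
  p₁ : obj ⟶ X
  /-- the second projection -/
  p₂ : obj ⟶ X
  fibration : Fibration (prod.lift p₁ p₂)
  refl : ∃ r : X ⟶ obj, r ≫ p₁ = 𝟙 X ∧ r ≫ p₂ = 𝟙 X
  symm : ∃ s : obj ⟶ obj, s ≫ p₁ = p₂ ∧ s ≫ p₂ = p₁
  trans : ∀ {Q : C} (q₁ q₂ : Q ⟶ obj), IsPullback q₁ q₂ p₂ p₁ →
    ∃ t : Q ⟶ obj, t ≫ p₁ = q₁ ≫ p₁ ∧ t ≫ p₂ = q₂ ≫ p₂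

namespace HomotopyEqRel

variable {X : C} (R : HomotopyEqRel X)

/-- Two generalised elements of `X` are `R`-equivalent if the induced map to `X ⨯ X` factors
through `R`. -/
def Rel {Z : C} (a b : Z ⟶ X) : Prop := ∃ h : Z ⟶ R.obj, h ≫ R.p₁ = a ∧ h ≫ R.p₂ = b

variable {R}

theorem Rel.refl {Z : C} (a : Z ⟶ X) : R.Rel a a := by
  obtain ⟨r, h₁, h₂⟩ := R.refl
  exact ⟨a ≫ r, by simp [h₁], by simp [h₂]⟩

theorem Rel.symm {Z : C} {a b : Z ⟶ X} (h : R.Rel a b) : R.Rel b a := by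
  obtain ⟨s, h₁, h₂⟩ := R.symm
  obtain ⟨k, rfl, rfl⟩ := h
  exact ⟨k ≫ s, by simp [h₁], by simp [h₂]⟩

theorem Rel.trans {Z : C} {a b c : Z ⟶ X} (h : R.Rel a b) (h' : R.Rel b c) : R.Rel a c := by
  have := R.fibration
  have e : prod.lift R.p₁ R.p₂ ≫ prod.fst = R.p₁ := prod.lift_fst _ _
  have : Fibration R.p₁ := by rw [← e]; infer_instance
  obtain ⟨t, h₁, h₂⟩ := R.trans _ _ (IsPullback.of_hasPullback R.p₂ R.p₁)
  obtain ⟨k, rfl, rfl⟩ := h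
  obtain ⟨l, hl, rfl⟩ := h'
  exact ⟨pullback.lift k l hl.symm ≫ t, by rw [Category.assoc, h₁, pullback.lift_fst_assoc],
    by rw [Category.assoc, h₂, pullback.lift_snd_assoc]⟩

theorem Rel.precomp {Z W : C} {a b : Z ⟶ X} (h : R.Rel a b) (f : W ⟶ Z) :
    R.Rel (f ≫ a) (f ≫ b) := by
  obtain ⟨k, rfl, rfl⟩ := h
  exact ⟨f ≫ k, by simp, by simp⟩

/-- A path object on `X` is a homotopy equivalence relation on `X`. -/
def ofPathObject (P : PathObject X) [hP : P.IsGood] : HomotopyEqRel X where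
  obj := P.P
  p₁ := P.p₀
  p₂ := P.p₁
  fibration := hP.fibration_p
  refl := ⟨P.ι, by simp, by simp⟩
  symm := by
    have e₁ : prod.lift P.p₁ P.p₀ ≫ prod.fst = P.p₁ := prod.lift_fst _ _
    have e₂ : prod.lift P.p₁ P.p₀ ≫ prod.snd = P.p₀ := prod.lift_snd _ _
    obtain ⟨l, hl⟩ := exists_lower_filler P.ι P.ι P.p (prod.lift P.p₁ P.p₀)
      (by
        apply Limits.prod.hom_ext
        · simp only [Category.assoc, e₁, P.p_fst, PrepathObject.ι_p₀, PrepathObject.ι_p₁]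
        · simp only [Category.assoc, e₂, P.p_snd, PrepathObject.ι_p₀, PrepathObject.ι_p₁])
    exact ⟨l, by rw [← e₁, ← hl]; simp, by rw [← e₂, ← hl]; simp⟩
  trans {Q} q₁ q₂ sq := by
    have hq₁ : WeakEquivalence q₁ := weakEquivalence_of_isPullback sq.flip inferInstance
      inferInstance
    let α : X ⟶ Q := sq.lift P.ι P.ι (by simp)
    have α₁ : α ≫ q₁ = P.ι := sq.lift_fst _ _ _
    have α₂ : α ≫ q₂ = P.ι := sq.lift_snd _ _ _
    have hα : WeakEquivalence α := by
      have : WeakEquivalence (α ≫ q₁) := by rw [α₁]; infer_instance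
      exact weakEquivalence_of_postcomp α q₁
    have e₁ : prod.lift (q₁ ≫ P.p₀) (q₂ ≫ P.p₁) ≫ prod.fst = q₁ ≫ P.p₀ := prod.lift_fst _ _
    have e₂ : prod.lift (q₁ ≫ P.p₀) (q₂ ≫ P.p₁) ≫ prod.snd = q₂ ≫ P.p₁ := prod.lift_snd _ _
    obtain ⟨l, hl⟩ := exists_lower_filler P.ι α P.p (prod.lift (q₁ ≫ P.p₀) (q₂ ≫ P.p₁))
      (by
        apply Limits.prod.hom_ext
        · simp only [Category.assoc, e₁, P.p_fst, reassoc_of% α₁]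
        · simp only [Category.assoc, e₂, P.p_snd, reassoc_of% α₂])
    exact ⟨l, by rw [← e₁, ← hl]; simp, by rw [← e₂, ← hl]; simp⟩

end HomotopyEqRel

variable (C) in
/-- The objects of the homotopy exact completion `Hex(C)`: objects of `C` with a homotopy
equivalence relation. -/
structure Hex where
  /-- the underlying object -/
  carrier : C
  /-- the homotopy equivalence relation -/
  rel : HomotopyEqRel carrier

namespace Hex

/-- A map `f` between the underlying objects is tracked if `f × f` lifts to a map between the
homotopy equivalence relations. -/
def Tracked (A B : Hex C) (f : A.carrier ⟶ B.carrier) : Prop :=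
  ∃ φ : A.rel.obj ⟶ B.rel.obj, φ ≫ B.rel.p₁ = A.rel.p₁ ≫ f ∧ φ ≫ B.rel.p₂ = A.rel.p₂ ≫ f

theorem Tracked.rel {A B : Hex C} {f : A.carrier ⟶ B.carrier} (hf : Tracked A B f) {Z : C}
    {a b : Z ⟶ A.carrier} (h : A.rel.Rel a b) : B.rel.Rel (a ≫ f) (b ≫ f) := by
  obtain ⟨φ, h₁, h₂⟩ := hf
  obtain ⟨k, rfl, rfl⟩ := h
  exact ⟨k ≫ φ, by simp [h₁], by simp [h₂]⟩

theorem Tracked.id (A : Hex C) : Tracked A A (𝟙 A.carrier) := ⟨𝟙 _, by simp, by simp⟩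

theorem Tracked.comp {A B D : Hex C} {f : A.carrier ⟶ B.carrier} {g : B.carrier ⟶ D.carrier}
    (hf : Tracked A B f) (hg : Tracked B D g) : Tracked A D (f ≫ g) := by
  obtain ⟨φ, h₁, h₂⟩ := hf
  obtain ⟨ψ, k₁, k₂⟩ := hg
  exact ⟨φ ≫ ψ, by simp [k₁, reassoc_of% h₁], by simp [k₂, reassoc_of% h₂]⟩

/-- Two tracked maps `f, g : X ⟶ Y` into `(Y, S)` are identified if `(f, g)` factors through
`S`. -/
def homSetoid (A B : Hex C) : Setoid {f : A.carrier ⟶ B.carrier // Tracked A B f} where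
  r f g := B.rel.Rel f.1 g.1
  iseqv := ⟨fun f => .refl f.1, fun h => h.symm, fun h h' => h.trans h'⟩

/-- The homotopy exact completion of a path category: morphisms are equivalence classes of
tracked maps. -/
instance : Category.{v} (Hex C) where
  Hom A B := Quotient (homSetoid A B)
  id A := Quotient.mk _ ⟨𝟙 _, Tracked.id A⟩
  comp {A B D} := Quotient.map₂ (fun f g => ⟨f.1 ≫ g.1, f.2.comp g.2⟩)
    (fun f _ hf _ g' hg =>
      HomotopyEqRel.Rel.trans (HomotopyEqRel.Rel.precomp hg f.1) (g'.2.rel hf))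
  id_comp := by
    rintro A B ⟨f⟩
    exact congrArg (Quotient.mk _) (Subtype.ext (Category.id_comp _))
  comp_id := by
    rintro A B ⟨f⟩
    exact congrArg (Quotient.mk _) (Subtype.ext (Category.comp_id _))
  assoc := by
    rintro A B D E ⟨f⟩ ⟨g⟩ ⟨h⟩
    exact congrArg (Quotient.mk _) (Subtype.ext (Category.assoc _ _ _))

/-- The object `i(X) = (X, PX)` of `Hex(C)`, for a path object `PX` on `X`. -/
def i {X : C} (P : PathObject X) [P.IsGood] : Hex C := ⟨X, .ofPathObject P⟩

/-! #### Transport and stable objects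

Let `A = (f : Y ⟶ X, T)` be an object of `Hex(C(X))`. -/

variable {X : C}

/-- The underlying object `Y` in `C`. -/
abbrev total (A : Hex (FibOver X)) : C := A.carrier.obj.left

/-- The fibration `f : Y ⟶ X`. -/
abbrev proj (A : Hex (FibOver X)) : A.total ⟶ X := A.carrier.obj.hom

instance (A : Hex (FibOver X)) : Fibration A.proj := A.carrier.property

/-- Two generalised elements `a, b : Z ⟶ Y` in `C` are `T`-equivalent if the map `(a, b)` factors
through `T`. (They are then automatically in the same fibre of `f`. The object `Z` is arbitrary,
and does not have to be fibred over `X`.) -/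
def FibreRel (A : Hex (FibOver X)) {Z : C} (a b : Z ⟶ A.total) : Prop :=
  ∃ h : Z ⟶ A.rel.obj.obj.left, h ≫ A.rel.p₁.hom.left = a ∧ h ≫ A.rel.p₂.hom.left = b

/-- A map `Γ : Y ×_X PX ⟶ Y`, with `Y ×_X PX` the pullback of `f` and the source map of `PX`,
is a `T`-transport if `f Γ(y, α)` is the target of `α`, and `Γ(y, r (f y))` is `T`-equivalent
to `y`. -/
def IsTransport (A : Hex (FibOver X)) (P : PathObject X)
    (Γ : pullback A.proj P.p₀ ⟶ A.total) : Prop :=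
  Γ ≫ A.proj = pullback.snd A.proj P.p₀ ≫ P.p₁ ∧
    A.FibreRel (𝟙 A.total) (pullback.lift (𝟙 A.total) (A.proj ≫ P.ι) (by simp) ≫ Γ)

/-- The object `A` is stable if loops in `X` act `T`-trivially: `Γ(y, α)` is `T`-equivalent
to `y` for all generalised elements `y` of `Y` and all loops `α` at `f y`, where `Γ` is a
`T`-transport. (A `T`-transport exists and is unique up to `T`-equivalence.) -/
def IsStable (P : PathObject X) : ObjectProperty (Hex (FibOver X)) := fun A =>
  ∃ Γ : pullback A.proj P.p₀ ⟶ A.total, A.IsTransport P Γ ∧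
    ∀ {Z : C} (y : Z ⟶ A.total) (α : Z ⟶ P.P)
      (h₀ : y ≫ A.proj = α ≫ P.p₀) (_ : y ≫ A.proj = α ≫ P.p₁),
      A.FibreRel (pullback.lift y α h₀ ≫ Γ) y

end Hex

end Hex

end PathCategory

/-! The equivalence comes from an adjunction `toOver` ⊣ `ofOverFunctor` with invertible counit,
whose right adjoint has exactly the stable objects as essential image.

An object (f : Y → X, T) of Hex(C(X)) only compares points within one fibre. The left adjoint glues
the fibres together: on Y, put y ~ y' when the transport of y along some path in X is T-related to
y' (`PathRel`). The right adjoint takes an object D over i(X), represented by h, to its homotopy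
fibres: pairs (d, path from h d to x), fibred over x, where two pairs over the same x are related
when their components in D are. The path itself is forgotten by this relation. A map from (f, T) to
this object amounts to a map k : Y → D with a path from h k to f, and the existence of such a path
is what makes k a morphism over i(X); hence the adjunction (`bijective_comp_fromOfOver`).

The counit (d, path) ↦ d is invertible because two pairs with related first components can always be
joined by transport (`pathRel_pathPullback_iff`). Transport does not change the first component up
to the relation of D, so loops act trivially and the image is stable. Conversely, a path relating
two points of the same fibre is a loop, so for stable objects `PathRel` restricts to T on fibres
(`IsStable.fibreRel_of_pathRel`), and the unit is invertible.

All laws of transport are proved by path induction: the inclusion of constant paths is a weak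
equivalence, and a relation represented by a fibration can be tested along weak equivalences. No
inverse or composite of paths has to be analysed. -/

namespace PathCategory

variable {C : Type u} [Category.{v} C] [CategoryWithFibrations C]
  [CategoryWithWeakEquivalences C] [PathCategory C]

/-! ### Relations represented by fibrations -/

/-- Whether a pair of maps factors through a fibration can be tested along weak equivalences. -/
theorem exists_lift_of_weakEquivalence {Y R : C} (q : R ⟶ Y ⨯ Y) [Fibration q] {D Z : C}
    (w : D ⟶ Z) [WeakEquivalence w] {a b : Z ⟶ Y}
    (h : ∃ k : D ⟶ R, k ≫ q ≫ prod.fst = w ≫ a ∧ k ≫ q ≫ prod.snd = w ≫ b) :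
    ∃ k : Z ⟶ R, k ≫ q ≫ prod.fst = a ∧ k ≫ q ≫ prod.snd = b := by
  obtain ⟨k, h₁, h₂⟩ := h
  obtain ⟨l, hl⟩ := exists_lower_filler k w q (prod.lift a b) (by
    apply Limits.prod.hom_ext
    · simpa only [Category.assoc, prod.lift_fst] using h₁
    · simpa only [Category.assoc, prod.lift_snd] using h₂)
  exact ⟨l, by rw [reassoc_of% hl, prod.lift_fst], by rw [reassoc_of% hl, prod.lift_snd]⟩

/-- A homotopy equivalence relation, from a fibration representing equivalence relations on
generalised elements. -/
noncomputable def HomotopyEqRel.ofRel {Y R : C} (q : R ⟶ Y ⨯ Y) [Fibration q]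
    (r : ∀ Z : C, (Z ⟶ Y) → (Z ⟶ Y) → Prop) (hr : ∀ Z, Equivalence (r Z))
    (hq : ∀ {Z : C} (a b : Z ⟶ Y),
      r Z a b ↔ ∃ k : Z ⟶ R, k ≫ q ≫ prod.fst = a ∧ k ≫ q ≫ prod.snd = b) :
    HomotopyEqRel Y where
  obj := R
  p₁ := q ≫ prod.fst
  p₂ := q ≫ prod.snd
  fibration := by rwa [← prod.comp_lift, prod.lift_fst_snd, Category.comp_id]
  refl := (hq _ _).1 ((hr _).refl _)
  symm := (hq _ _).1 ((hr _).symm ((hq _ _).2 ⟨𝟙 _, Category.id_comp _, Category.id_comp _⟩))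
  trans q₁ q₂ sq := (hq _ _).1
    ((hr _).trans ((hq _ _).2 ⟨q₁, rfl, sq.w⟩) ((hq _ _).2 ⟨q₂, rfl, rfl⟩))

theorem HomotopyEqRel.rel_ofRel {Y R : C} (q : R ⟶ Y ⨯ Y) [Fibration q]
    {r : ∀ Z : C, (Z ⟶ Y) → (Z ⟶ Y) → Prop} (hr : ∀ Z, Equivalence (r Z))
    (hq : ∀ {Z : C} (a b : Z ⟶ Y),
      r Z a b ↔ ∃ k : Z ⟶ R, k ≫ q ≫ prod.fst = a ∧ k ≫ q ≫ prod.snd = b)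
    {Z : C} (a b : Z ⟶ Y) : (HomotopyEqRel.ofRel q r hr hq).Rel a b ↔ r Z a b :=
  (hq a b).symm

theorem weakEquivalence_of_section {D Z : C} (s : D ⟶ Z) (q : Z ⟶ D) [WeakEquivalence q]
    (h : s ≫ q = 𝟙 D) : WeakEquivalence s := by
  have : WeakEquivalence (s ≫ q) := by rw [h]; infer_instance
  exact weakEquivalence_of_postcomp s q

/-! ### Relations in C(X) described in C -/

section Fibres

variable {X : C}

instance (B : FibOver X) : Fibration B.obj.hom := B.property

/-- The underlying object of a product in `C(X)` is a fibre product over `X`. -/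
theorem FibOver.isPullback_prod (A B : FibOver X) :
    IsPullback (prod.fst : A ⨯ B ⟶ A).hom.left (prod.snd : A ⨯ B ⟶ B).hom.left
      A.obj.hom B.obj.hom := by
  have : IsPullback (prod.fst : A ⨯ B ⟶ A) (prod.snd : A ⨯ B ⟶ B)
      (FibOver.isTerminalId.from A) (FibOver.isTerminalId.from B) :=
    IsPullback.of_is_product (prodIsProd A B) FibOver.isTerminalId
  refine FibOver.isPullback_left this ?_
  rw [fibOver_fibration_iff]
  exact A.property

/-- The square of B in C(X) is the fibre product over X, so the two maps differ by an isomorphism of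
codomains. -/
theorem FibOver.fibration_prodLift_iff {B T : FibOver X} (p₁ p₂ : T ⟶ B)
    (h : p₁.hom.left ≫ B.obj.hom = p₂.hom.left ≫ B.obj.hom) :
    Fibration (prod.lift p₁ p₂) ↔
      Fibration (pullback.lift (f := B.obj.hom) (g := B.obj.hom) p₁.hom.left p₂.hom.left h) := by
  rw [fibOver_fibration_iff]
  let e := (FibOver.isPullback_prod B B).isoPullback
  have he : (prod.lift p₁ p₂).hom.left ≫ e.hom = pullback.lift p₁.hom.left p₂.hom.left h := by
    apply pullback.hom_ext
    · rw [Category.assoc, IsPullback.isoPullback_hom_fst, pullback.lift_fst, ← FibOver.comp_left,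
        prod.lift_fst]
    · rw [Category.assoc, IsPullback.isoPullback_hom_snd, pullback.lift_snd, ← FibOver.comp_left,
        prod.lift_snd]
  constructor
  · intro hf
    rw [← he]
    infer_instance
  · intro hf
    rw [← Iso.eq_comp_inv] at he
    rw [he]
    infer_instance

theorem FibOver.proj_eq_of_map (B : FibOver X) {T : C} (q : T ⟶ pullback B.obj.hom B.obj.hom) :
    (q ≫ pullback.fst _ _) ≫ B.obj.hom = (q ≫ pullback.snd _ _) ≫ B.obj.hom := by
  rw [Category.assoc, pullback.condition, Category.assoc]

/-- A homotopy equivalence relation in `C(X)`, from a fibration in `C` to the fibre product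
representing equivalence relations on generalised elements. -/
noncomputable def FibOver.homotopyEqRelOfRel (B : FibOver X) {T : C}
    (q : T ⟶ pullback B.obj.hom B.obj.hom) [hasq : Fibration q]
    (r : ∀ Z : C, (Z ⟶ B.obj.left) → (Z ⟶ B.obj.left) → Prop) (hr : ∀ Z, Equivalence (r Z))
    (hq : ∀ {Z : C} (a b : Z ⟶ B.obj.left), r Z a b ↔
      ∃ k : Z ⟶ T, k ≫ q ≫ pullback.fst _ _ = a ∧ k ≫ q ≫ pullback.snd _ _ = b) :
    HomotopyEqRel B where
  obj := FibOver.mk ((q ≫ pullback.fst _ _) ≫ B.obj.hom) inferInstance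
  p₁ := FibOver.homMk (q ≫ pullback.fst _ _) rfl
  p₂ := FibOver.homMk (q ≫ pullback.snd _ _) (FibOver.proj_eq_of_map B q).symm
  fibration := by
    refine (FibOver.fibration_prodLift_iff _ _ (FibOver.proj_eq_of_map B q)).2 ?_
    have e : pullback.lift (f := B.obj.hom) (g := B.obj.hom) (q ≫ pullback.fst _ _)
        (q ≫ pullback.snd _ _) (FibOver.proj_eq_of_map B q) = q :=
      pullback.hom_ext (pullback.lift_fst _ _ _) (pullback.lift_snd _ _ _)
    have : Fibration (pullback.lift (f := B.obj.hom) (g := B.obj.hom) (q ≫ pullback.fst _ _)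
        (q ≫ pullback.snd _ _) (FibOver.proj_eq_of_map B q)) := by rw [e]; infer_instance
    exact this
  refl := by
    obtain ⟨k, h₁, h₂⟩ := (hq _ _).1 ((hr _).refl (𝟙 B.obj.left))
    refine ⟨FibOver.homMk k ?_, FibOver.hom_ext h₁, FibOver.hom_ext h₂⟩
    exact (Category.assoc _ _ _).symm.trans ((congrArg (· ≫ B.obj.hom) h₁).trans
      (Category.id_comp _))
  symm := by
    obtain ⟨k, h₁, h₂⟩ := (hq _ _).1 ((hr _).symm ((hq _ _).2
      ⟨𝟙 _, Category.id_comp _, Category.id_comp _⟩))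
    refine ⟨FibOver.homMk k ?_, FibOver.hom_ext h₁, FibOver.hom_ext h₂⟩
    exact (Category.assoc _ _ _).symm.trans ((congrArg (· ≫ B.obj.hom) h₁).trans
      (FibOver.proj_eq_of_map B q).symm)
  trans {Q} q₁ q₂ sq := by
    obtain ⟨k, h₁, h₂⟩ := (hq _ _).1
      ((hr _).trans ((hq _ _).2 ⟨q₁.hom.left, rfl, congr(($(sq.w)).hom.left)⟩)
        ((hq _ _).2 ⟨q₂.hom.left, rfl, rfl⟩))
    refine ⟨FibOver.homMk k ?_, FibOver.hom_ext h₁, FibOver.hom_ext h₂⟩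
    exact (Category.assoc _ _ _).symm.trans ((congrArg (· ≫ B.obj.hom) h₁).trans
      ((Category.assoc _ _ _).trans (FibOver.left_w q₁)))

end Fibres

/-! ### Morphisms of Hex by representatives -/

namespace Hex

/-- A tracked map defines a morphism. -/
def homOf {A B : Hex C} (f : A.carrier ⟶ B.carrier) (hf : Tracked A B f) : A ⟶ B :=
  Quotient.mk (homSetoid A B) ⟨f, hf⟩

theorem homOf_eq_iff {A B : Hex C} {f g : A.carrier ⟶ B.carrier} {hf : Tracked A B f}
    {hg : Tracked A B g} : homOf f hf = homOf g hg ↔ B.rel.Rel f g :=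
  Quotient.eq (r := homSetoid A B)

theorem homOf_comp {A B D : Hex C} {f : A.carrier ⟶ B.carrier} {g : B.carrier ⟶ D.carrier}
    (hf : Tracked A B f) (hg : Tracked B D g) :
    homOf f hf ≫ homOf g hg = homOf (f ≫ g) (hf.comp hg) := rfl

theorem homOf_id (A : Hex C) : homOf (𝟙 A.carrier) (Tracked.id A) = 𝟙 A := rfl

theorem exists_homOf {A B : Hex C} (φ : A ⟶ B) : ∃ f hf, homOf f hf = φ := by
  obtain ⟨⟨f, hf⟩, rfl⟩ := Quotient.exists_rep φ
  exact ⟨f, hf, rfl⟩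

/-- Yoneda: a tracking map is the condition applied to the universal related pair `(p₁, p₂)`. -/
theorem tracked_iff {A B : Hex C} (f : A.carrier ⟶ B.carrier) :
    Tracked A B f ↔ ∀ {Z : C} {a b : Z ⟶ A.carrier}, A.rel.Rel a b →
      B.rel.Rel (a ≫ f) (b ≫ f) :=
  ⟨fun hf _ _ _ h => hf.rel h, fun h => h ⟨𝟙 _, by simp, by simp⟩⟩

/-- A tracked map which reflects the relations and is surjective up to the relation is an
isomorphism. -/
theorem isIso_homOf {A B : Hex C} {f : A.carrier ⟶ B.carrier} (hf : Tracked A B f)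
    (refl : ∀ {Z : C} {a b : Z ⟶ A.carrier}, B.rel.Rel (a ≫ f) (b ≫ f) → A.rel.Rel a b)
    (g : B.carrier ⟶ A.carrier) (hg : B.rel.Rel (g ≫ f) (𝟙 _)) : IsIso (homOf f hf) := by
  -- The quasi-inverse is automatically tracked: a ~ b gives f g a ~ a ~ b ~ f g b, and f reflects
  -- the relation.
  have hg' : Tracked B A g := (tracked_iff g).2 fun {Z a b} h => refl <| by
    have h₁ := hg.precomp a
    have h₂ := hg.precomp b
    rw [Category.comp_id] at h₁ h₂
    simpa only [Category.assoc] using (h₁.trans h).trans h₂.symm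
  refine ⟨homOf g hg', ?_, ?_⟩
  · rw [homOf_comp, ← homOf_id, homOf_eq_iff]
    refine refl ?_
    simpa using hg.precomp f
  · rw [homOf_comp, ← homOf_id, homOf_eq_iff]
    exact hg

/-! ### The fibrewise relation on elements not fibred over X -/

section Fibres

variable {X : C} {A : Hex (FibOver X)}

theorem FibreRel.refl {Z : C} (a : Z ⟶ A.total) : A.FibreRel a a := by
  obtain ⟨r, h₁, h₂⟩ := A.rel.refl
  have h₁' := congr(($h₁).hom.left)
  have h₂' := congr(($h₂).hom.left)
  simp only [FibOver.comp_left, FibOver.id_left] at h₁' h₂'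
  exact ⟨a ≫ r.hom.left, by simp [h₁'], by simp [h₂']⟩

theorem FibreRel.symm {Z : C} {a b : Z ⟶ A.total} (h : A.FibreRel a b) : A.FibreRel b a := by
  obtain ⟨s, h₁, h₂⟩ := A.rel.symm
  obtain ⟨k, rfl, rfl⟩ := h
  have h₁' := congr(($h₁).hom.left)
  have h₂' := congr(($h₂).hom.left)
  simp only [FibOver.comp_left] at h₁' h₂'
  exact ⟨k ≫ s.hom.left, by simp [h₁'], by simp [h₂']⟩

theorem FibreRel.proj_eq {Z : C} {a b : Z ⟶ A.total} (h : A.FibreRel a b) :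
    a ≫ A.proj = b ≫ A.proj := by
  obtain ⟨k, rfl, rfl⟩ := h
  rw [Category.assoc, Category.assoc]
  exact congr(k ≫ $((FibOver.left_w A.rel.p₁).trans (FibOver.left_w A.rel.p₂).symm))

theorem FibreRel.precomp {Z W : C} {a b : Z ⟶ A.total} (h : A.FibreRel a b) (f : W ⟶ Z) :
    A.FibreRel (f ≫ a) (f ≫ b) := by
  obtain ⟨k, rfl, rfl⟩ := h
  exact ⟨f ≫ k, by simp, by simp⟩

theorem FibreRel.trans {Z : C} {a b c : Z ⟶ A.total} (h : A.FibreRel a b)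
    (h' : A.FibreRel b c) : A.FibreRel a c := by
  have := A.rel.fibration
  have hp : Fibration A.rel.p₂ := by rw [← prod.lift_snd A.rel.p₁ A.rel.p₂]; infer_instance
  have sq := IsPullback.of_hasPullback A.rel.p₂ A.rel.p₁
  have sq' := FibOver.isPullback_left sq hp
  obtain ⟨t, h₁, h₂⟩ := A.rel.trans _ _ sq
  have h₁' := congr(($h₁).hom.left)
  have h₂' := congr(($h₂).hom.left)
  simp only [FibOver.comp_left] at h₁' h₂'
  obtain ⟨k, rfl, rfl⟩ := h
  obtain ⟨l, hl, rfl⟩ := h'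
  exact ⟨sq'.lift k l hl.symm ≫ t.hom.left,
    by rw [Category.assoc, h₁', sq'.lift_fst_assoc],
    by rw [Category.assoc, h₂', sq'.lift_snd_assoc]⟩

variable (A) in
theorem rel_w : A.rel.p₁.hom.left ≫ A.proj = A.rel.p₂.hom.left ≫ A.proj :=
  (FibOver.left_w A.rel.p₁).trans (FibOver.left_w A.rel.p₂).symm

variable (A) in
/-- The relation of an object of `Hex(C(X))`, as a map to the fibre product in `C`. -/
noncomputable def relMap : A.rel.obj.obj.left ⟶ pullback A.proj A.proj :=
  pullback.lift A.rel.p₁.hom.left A.rel.p₂.hom.left A.rel_w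

instance : Fibration A.relMap := (FibOver.fibration_prodLift_iff _ _ A.rel_w).1 A.rel.fibration

@[simp]
theorem relMap_fst : A.relMap ≫ pullback.fst A.proj A.proj = A.rel.p₁.hom.left :=
  pullback.lift_fst _ _ _

@[simp]
theorem relMap_snd : A.relMap ≫ pullback.snd A.proj A.proj = A.rel.p₂.hom.left :=
  pullback.lift_snd _ _ _

/-- Fibrewise relatedness can be tested along weak equivalences. -/
theorem FibreRel.of_weakEquivalence {D Z : C} (w : D ⟶ Z) [WeakEquivalence w]
    {a b : Z ⟶ A.total} (e : a ≫ A.proj = b ≫ A.proj) (h : A.FibreRel (w ≫ a) (w ≫ b)) :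
    A.FibreRel a b := by
  obtain ⟨k, h₁, h₂⟩ := h
  have e₁ : pullback.lift a b e ≫ pullback.fst A.proj A.proj = a := pullback.lift_fst _ _ _
  have e₂ : pullback.lift a b e ≫ pullback.snd A.proj A.proj = b := pullback.lift_snd _ _ _
  obtain ⟨l, hl⟩ := exists_lower_filler k w A.relMap (pullback.lift a b e) (by
    apply pullback.hom_ext
    · simpa [e₁] using h₁
    · simpa [e₂] using h₂)
  exact ⟨l, by simpa [e₁] using congr($hl ≫ pullback.fst _ _),
    by simpa [e₂] using congr($hl ≫ pullback.snd _ _)⟩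

theorem rel_iff {Z : FibOver X} (a b : Z ⟶ A.carrier) :
    A.rel.Rel a b ↔ A.FibreRel a.hom.left b.hom.left := by
  constructor
  · rintro ⟨k, rfl, rfl⟩
    exact ⟨k.hom.left, rfl, rfl⟩
  · rintro ⟨k, h₁, h₂⟩
    refine ⟨FibOver.homMk k ?_, FibOver.hom_ext h₁, FibOver.hom_ext h₂⟩
    rw [← FibOver.left_w A.rel.p₁, reassoc_of% h₁]
    exact FibOver.left_w a

theorem Tracked.fibreRel {A B : Hex (FibOver X)} {f : A.carrier ⟶ B.carrier} (hf : Tracked A B f)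
    {Z : C} {a b : Z ⟶ A.total} (h : A.FibreRel a b) :
    B.FibreRel (a ≫ f.hom.left) (b ≫ f.hom.left) := by
  obtain ⟨φ, h₁, h₂⟩ := hf
  obtain ⟨k, rfl, rfl⟩ := h
  have h₁' := congr(($h₁).hom.left)
  have h₂' := congr(($h₂).hom.left)
  simp only [FibOver.comp_left] at h₁' h₂'
  exact ⟨k ≫ φ.hom.left, by simp [h₁'], by simp [h₂']⟩

/-- Refines `exists_lower_filler`: the upper triangle also commutes, up to T. This is the source of
transports. -/
theorem exists_filler_fibreRel {D B : C} (g : D ⟶ A.total) (w : D ⟶ B) [WeakEquivalence w]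
    (f : B ⟶ X) (comm : g ≫ A.proj = w ≫ f) :
    ∃ l : B ⟶ A.total, l ≫ A.proj = f ∧ A.FibreRel g (w ≫ l) := by
  obtain ⟨Z, i, q, hiq, _, _⟩ := exists_factorization (pullback.lift w g comm.symm)
  have hi₁ : i ≫ q ≫ pullback.fst f A.proj = w := by rw [reassoc_of% hiq, pullback.lift_fst]
  have hi₂ : i ≫ q ≫ pullback.snd f A.proj = g := by rw [reassoc_of% hiq, pullback.lift_snd]
  have : WeakEquivalence (i ≫ q ≫ pullback.fst f A.proj) := by rw [hi₁]; infer_instance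
  have : WeakEquivalence (q ≫ pullback.fst f A.proj) := weakEquivalence_of_precomp i _
  set π := q ≫ pullback.fst f A.proj with hπ
  obtain ⟨a, ha⟩ := exists_section π inferInstance inferInstance
  have cond : (q ≫ pullback.snd f A.proj) ≫ A.proj = π ≫ f := by
    rw [hπ, Category.assoc, Category.assoc, pullback.condition]
  refine ⟨a ≫ q ≫ pullback.snd f A.proj, by rw [Category.assoc, cond, reassoc_of% ha], ?_⟩
  have : WeakEquivalence (pullback.fst π π) :=
    weakEquivalence_of_isPullback (IsPullback.of_hasPullback π π).flip inferInstance inferInstance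
  have hδ : pullback.lift (𝟙 Z) (𝟙 Z) rfl ≫ pullback.fst π π = 𝟙 Z := pullback.lift_fst _ _ _
  have := weakEquivalence_of_section _ _ hδ
  -- As π is an acyclic fibration, the diagonal into its kernel pair is a weak equivalence. So it
  -- suffices to compare the two maps on the diagonal, where they agree.
  have key : A.FibreRel (pullback.fst π π ≫ q ≫ pullback.snd f A.proj)
      (pullback.snd π π ≫ q ≫ pullback.snd f A.proj) := by
    refine FibreRel.of_weakEquivalence (pullback.lift (𝟙 Z) (𝟙 Z) rfl) ?_ ?_
    · rw [Category.assoc, cond, Category.assoc (pullback.snd π π), cond, pullback.condition_assoc]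
    · rw [pullback.lift_fst_assoc, pullback.lift_snd_assoc]
      exact .refl _
  -- Both i and w ≫ a lie over w, hence define a map to the kernel pair of π.
  have := key.precomp (pullback.lift i (w ≫ a) (by rw [Category.assoc, ha, hi₁, Category.comp_id]))
  rwa [pullback.lift_fst_assoc, pullback.lift_snd_assoc, hi₂, Category.assoc] at this

end Fibres

/-! ### Transport and path induction -/

section Transport

variable {X : C} {A B : Hex (FibOver X)} {P : PathObject X} [P.IsGood]

/-- The inclusion of the constant paths. -/
noncomputable def constPath {Z : C} (g : Z ⟶ X) : Z ⟶ pullback g P.p₀ :=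
  pullback.lift (𝟙 Z) (g ≫ P.ι) (by simp)

theorem constPath_fst {Z : C} (g : Z ⟶ X) : constPath g ≫ pullback.fst g P.p₀ = 𝟙 Z :=
  pullback.lift_fst _ _ _

theorem constPath_snd {Z : C} (g : Z ⟶ X) : constPath g ≫ pullback.snd g P.p₀ = g ≫ P.ι :=
  pullback.lift_snd _ _ _

instance {Z : C} (g : Z ⟶ X) : WeakEquivalence (constPath (P := P) g) := by
  have := weakEquivalence_of_isPullback (IsPullback.of_hasPullback g P.p₀).flip inferInstance
    inferInstance
  exact weakEquivalence_of_section _ _ (constPath_fst g)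

-- A transport is a filler of the square with the constant-path inclusion on the left and f on the
-- right.
variable (A P) in
theorem exists_isTransport : ∃ Γ, A.IsTransport P Γ := by
  obtain ⟨Γ, h₁, h₂⟩ := exists_filler_fibreRel (A := A) (𝟙 _) (constPath (P := P) A.proj)
    (pullback.snd A.proj P.p₀ ≫ P.p₁) (by rw [reassoc_of% constPath_snd]; simp)
  exact ⟨Γ, h₁, h₂⟩

/-- Path induction: fibrewise relatedness can be tested on constant paths. -/
theorem FibreRel.of_constPath {Z : C} {g : Z ⟶ X} {α : Z ⟶ P.P} (hα : g = α ≫ P.p₀)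
    {a b : pullback g P.p₀ ⟶ A.total} (e : a ≫ A.proj = b ≫ A.proj)
    (h : A.FibreRel (constPath g ≫ a) (constPath g ≫ b)) :
    A.FibreRel (pullback.lift (𝟙 Z) α (by simpa using hα) ≫ a)
      (pullback.lift (𝟙 Z) α (by simpa using hα) ≫ b) :=
  (FibreRel.of_weakEquivalence (constPath g) e h).precomp _

/-- The transport of `y` along `α`. -/
noncomputable def act (Γ : pullback A.proj P.p₀ ⟶ A.total) {Z : C} (y : Z ⟶ A.total)
    (α : Z ⟶ P.P) (h : y ≫ A.proj = α ≫ P.p₀) : Z ⟶ A.total :=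
  pullback.lift y α h ≫ Γ

theorem comp_act (Γ : pullback A.proj P.p₀ ⟶ A.total) {Z W : C} (f : W ⟶ Z) (y : Z ⟶ A.total)
    (α : Z ⟶ P.P) (h : y ≫ A.proj = α ≫ P.p₀) :
    f ≫ act Γ y α h = act Γ (f ≫ y) (f ≫ α) (by rw [Category.assoc, h, Category.assoc]) := by
  rw [act, act, ← Category.assoc]
  congr 1
  apply pullback.hom_ext
  · rw [Category.assoc, pullback.lift_fst, pullback.lift_fst]
  · rw [Category.assoc, pullback.lift_snd, pullback.lift_snd]

theorem act_congr (Γ : pullback A.proj P.p₀ ⟶ A.total) {Z : C} {y y' : Z ⟶ A.total}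
    {α α' : Z ⟶ P.P} (hy : y = y') (hα : α = α') (h : y ≫ A.proj = α ≫ P.p₀) :
    act Γ y α h = act Γ y' α' (hy ▸ hα ▸ h) := by
  subst hy hα; rfl

namespace IsTransport

variable {Γ : pullback A.proj P.p₀ ⟶ A.total} {Γ' : pullback B.proj P.p₀ ⟶ B.total}

theorem act_proj (hΓ : A.IsTransport P Γ) {Z : C} (y : Z ⟶ A.total) (α : Z ⟶ P.P)
    (h : y ≫ A.proj = α ≫ P.p₀) : act Γ y α h ≫ A.proj = α ≫ P.p₁ := by
  rw [act, Category.assoc, hΓ.1, pullback.lift_snd_assoc]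

theorem act_const (hΓ : A.IsTransport P Γ) {Z : C} (y : Z ⟶ A.total) (α : Z ⟶ P.P)
    (hα : α = y ≫ A.proj ≫ P.ι) :
    A.FibreRel y (act Γ y α (by simp [hα])) := by
  have := hΓ.2.precomp y
  change A.FibreRel _ (y ≫ act Γ _ _ (by simp)) at this
  rw [comp_act] at this
  subst hα
  simpa using this

/-- A transport commutes with tracked maps. -/
theorem act_comp (hΓ : A.IsTransport P Γ) (hΓ' : B.IsTransport P Γ')
    {f : A.carrier ⟶ B.carrier} (hf : Tracked A B f) {Z : C} (y : Z ⟶ A.total) (α : Z ⟶ P.P)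
    (h : y ≫ A.proj = α ≫ P.p₀) (h' : (y ≫ f.hom.left) ≫ B.proj = α ≫ P.p₀) :
    B.FibreRel (act Γ y α h ≫ f.hom.left) (act Γ' (y ≫ f.hom.left) α h') := by
  have hfp : f.hom.left ≫ B.proj = A.proj := FibOver.left_w f
  have c : (pullback.fst (y ≫ A.proj) P.p₀ ≫ y) ≫ A.proj = pullback.snd _ _ ≫ P.p₀ := by
    rw [Category.assoc, pullback.condition]
  have c' : (pullback.fst (y ≫ A.proj) P.p₀ ≫ y ≫ f.hom.left) ≫ B.proj =
      pullback.snd _ _ ≫ P.p₀ := by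
    rw [Category.assoc, Category.assoc, hfp, pullback.condition]
  -- The path α is replaced by the universal path starting at f y. On constant paths both transports
  -- are trivial by `act_const`.
  have key := FibreRel.of_constPath (A := B) (P := P) (g := y ≫ A.proj) (α := α) h
    (a := act Γ (pullback.fst _ _ ≫ y) (pullback.snd _ _) c ≫ f.hom.left)
    (b := act Γ' (pullback.fst _ _ ≫ y ≫ f.hom.left) (pullback.snd _ _) c')
    (by rw [Category.assoc, hfp, hΓ.act_proj, hΓ'.act_proj]) (by
      rw [← Category.assoc, comp_act, comp_act]
      have e₁ := hf.fibreRel (hΓ.act_const (constPath (P := P) (y ≫ A.proj) ≫ pullback.fst _ _ ≫ y)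
        (constPath (P := P) (y ≫ A.proj) ≫ pullback.snd _ _)
        (by rw [constPath_snd, reassoc_of% constPath_fst, Category.assoc]))
      have e₂ := hΓ'.act_const
        (constPath (P := P) (y ≫ A.proj) ≫ pullback.fst _ _ ≫ y ≫ f.hom.left)
        (constPath (P := P) (y ≫ A.proj) ≫ pullback.snd _ _)
        (by rw [constPath_snd, reassoc_of% constPath_fst, Category.assoc, Category.assoc,
          reassoc_of% hfp])
      refine e₁.symm.trans ?_
      simpa only [Category.assoc] using e₂)
  rw [← Category.assoc, comp_act, comp_act] at key
  rwa [act_congr Γ (pullback.lift_fst_assoc _ _ _ _) (pullback.lift_snd _ _ _),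
    act_congr Γ' (pullback.lift_fst_assoc _ _ _ _) (pullback.lift_snd _ _ _),
    act_congr Γ (Category.id_comp _) rfl, act_congr Γ' (Category.id_comp _) rfl] at key

/-- A transport respects the relation. -/
theorem act_rel (hΓ : A.IsTransport P Γ) {Z : C} {y y' : Z ⟶ A.total} (hy : A.FibreRel y y')
    (α : Z ⟶ P.P) (h : y ≫ A.proj = α ≫ P.p₀) (h' : y' ≫ A.proj = α ≫ P.p₀) :
    A.FibreRel (act Γ y α h) (act Γ y' α h') := by
  have c : (pullback.fst (y ≫ A.proj) P.p₀ ≫ y) ≫ A.proj = pullback.snd _ _ ≫ P.p₀ := by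
    rw [Category.assoc, pullback.condition]
  have c' : (pullback.fst (y ≫ A.proj) P.p₀ ≫ y') ≫ A.proj = pullback.snd _ _ ≫ P.p₀ := by
    rw [Category.assoc, ← hy.proj_eq, pullback.condition]
  have key := FibreRel.of_constPath (A := A) (P := P) (g := y ≫ A.proj) (α := α) h
    (a := act Γ (pullback.fst _ _ ≫ y) (pullback.snd _ _) c)
    (b := act Γ (pullback.fst _ _ ≫ y') (pullback.snd _ _) c')
    (by rw [hΓ.act_proj, hΓ.act_proj]) (by
      rw [comp_act, comp_act]
      refine (hΓ.act_const _ _ ?_).symm.trans (.trans ?_ (hΓ.act_const _ _ ?_))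
      · rw [constPath_snd, reassoc_of% constPath_fst, Category.assoc]
      · rw [reassoc_of% constPath_fst, reassoc_of% constPath_fst]
        exact hy
      · rw [constPath_snd, reassoc_of% constPath_fst, Category.assoc, ← reassoc_of% hy.proj_eq])
  rw [comp_act, comp_act] at key
  rwa [act_congr Γ (pullback.lift_fst_assoc _ _ _ _) (pullback.lift_snd _ _ _),
    act_congr Γ (y := _ ≫ _ ≫ y') (pullback.lift_fst_assoc _ _ _ _) (pullback.lift_snd _ _ _),
    act_congr Γ (Category.id_comp y) rfl, act_congr Γ (Category.id_comp y') rfl] at key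

/-- Transports are unique up to the relation. -/
theorem act_unique (hΓ : A.IsTransport P Γ) {Γ₂ : pullback A.proj P.p₀ ⟶ A.total}
    (hΓ₂ : A.IsTransport P Γ₂) {Z : C} (y : Z ⟶ A.total) (α : Z ⟶ P.P)
    (h : y ≫ A.proj = α ≫ P.p₀) : A.FibreRel (act Γ y α h) (act Γ₂ y α h) := by
  have := hΓ.act_comp hΓ₂ (Tracked.id A) y α h
    (by rw [FibOver.id_left]; simpa using h)
  simp only [FibOver.id_left, Category.comp_id] at this
  exact this

end IsTransport

variable (A P) in
/-- A choice of a transport. -/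
noncomputable def transport : pullback A.proj P.p₀ ⟶ A.total := (exists_isTransport A P).choose

variable (A P) in
theorem isTransport : A.IsTransport P (transport A P) := (exists_isTransport A P).choose_spec

/-! ### The relation generated by transport -/

variable (A P) in
/-- Two generalised elements of `Y` are related along paths if transport along some path takes
the first to an element related to the second. -/
def PathRel (Z : C) (y y' : Z ⟶ A.total) : Prop :=
  ∃ (α : Z ⟶ P.P) (h : y ≫ A.proj = α ≫ P.p₀), A.FibreRel (act (transport A P) y α h) y'

theorem pathRel_act {Z : C} (y : Z ⟶ A.total) (α : Z ⟶ P.P) (h : y ≫ A.proj = α ≫ P.p₀) :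
    PathRel A P Z y (act (transport A P) y α h) := ⟨α, h, .refl _⟩

theorem FibreRel.pathRel {Z : C} {y y' : Z ⟶ A.total} (h : A.FibreRel y y') :
    PathRel A P Z y y' :=
  ⟨y ≫ A.proj ≫ P.ι, by simp, ((isTransport A P).act_const _ _ rfl).symm.trans h⟩

theorem PathRel.trans_fibreRel {Z : C} {y y' y'' : Z ⟶ A.total} (h : PathRel A P Z y y')
    (h' : A.FibreRel y' y'') : PathRel A P Z y y'' := by
  obtain ⟨α, e, h⟩ := h
  exact ⟨α, e, h.trans h'⟩

theorem FibreRel.trans_pathRel {Z : C} {y y' y'' : Z ⟶ A.total} (h : A.FibreRel y y')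
    (h' : PathRel A P Z y' y'') : PathRel A P Z y y'' := by
  obtain ⟨α, e, h'⟩ := h'
  exact ⟨α, h.proj_eq.trans e, ((isTransport A P).act_rel h _ _ _).trans h'⟩

theorem PathRel.precomp {Z W : C} {y y' : Z ⟶ A.total} (h : PathRel A P Z y y') (f : W ⟶ Z) :
    PathRel A P W (f ≫ y) (f ≫ y') := by
  obtain ⟨α, e, h⟩ := h
  refine ⟨f ≫ α, by simp only [Category.assoc, e], ?_⟩
  rw [← comp_act]
  exact h.precomp f

variable (A P) in
theorem pathSquare_w :
    (pullback.fst (prod.map A.proj A.proj) P.p ≫ prod.fst) ≫ A.proj =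
        pullback.snd (prod.map A.proj A.proj) P.p ≫ P.p₀ ∧
      (pullback.fst (prod.map A.proj A.proj) P.p ≫ prod.snd) ≫ A.proj =
        pullback.snd (prod.map A.proj A.proj) P.p ≫ P.p₁ := by
  have h := pullback.condition (f := prod.map A.proj A.proj) (g := P.p)
  constructor
  · simpa using congr($h ≫ prod.fst)
  · simpa using congr($h ≫ prod.snd)

variable (A P) in
/-- Transport along a path from one fibre to the other, on the object of triples `(y, y', α)`
where `α` is a path from `f y` to `f y'`. -/
noncomputable def pathSquareAct :
    pullback (prod.map A.proj A.proj) P.p ⟶ pullback A.proj A.proj :=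
  pullback.lift (act (transport A P) _ _ (pathSquare_w A P).1)
    (pullback.fst (prod.map A.proj A.proj) P.p ≫ prod.snd)
    (((isTransport A P).act_proj _ _ _).trans (pathSquare_w A P).2.symm)

theorem pathSquareAct_fst : pathSquareAct A P ≫ pullback.fst _ _ =
    act (transport A P) _ _ (pathSquare_w A P).1 := pullback.lift_fst _ _ _

theorem pathSquareAct_snd : pathSquareAct A P ≫ pullback.snd _ _ =
    pullback.fst (prod.map A.proj A.proj) P.p ≫ prod.snd := pullback.lift_snd _ _ _

variable (A P) in
/-- The fibration representing `PathRel`. -/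
noncomputable def pathRelMap : pullback A.relMap (pathSquareAct A P) ⟶ A.total ⨯ A.total :=
  pullback.snd _ _ ≫ pullback.fst _ _

instance : Fibration (pathRelMap A P) := by unfold pathRelMap; infer_instance

/-- An element of the pullback is a triple (y, y', α) with a witness that Γ(y, α) is T-related to
y'. The map to Y × Y keeps only y and y'. -/
theorem pathRel_iff {Z : C} (y y' : Z ⟶ A.total) :
    PathRel A P Z y y' ↔ ∃ k, k ≫ pathRelMap A P ≫ prod.fst = y ∧
      k ≫ pathRelMap A P ≫ prod.snd = y' := by
  constructor
  · rintro ⟨α, h, k, hk₁, hk₂⟩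
    -- The path α ends at f y', because T-related elements lie in the same fibre.
    have e : prod.lift y y' ≫ prod.map A.proj A.proj = α ≫ P.p := by
      apply Limits.prod.hom_ext
      · rw [Category.assoc, Category.assoc, P.p_fst, prod.map_fst, prod.lift_fst_assoc, h]
      · rw [Category.assoc, Category.assoc, P.p_snd, prod.map_snd, prod.lift_snd_assoc,
          ← (isTransport A P).act_proj y α h, ← hk₂, ← hk₁, Category.assoc, Category.assoc, rel_w]
    have e₁ : pullback.lift (prod.lift y y') α e ≫ pullback.fst _ _ = prod.lift y y' :=
      pullback.lift_fst _ _ _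
    have e₂ : pullback.lift (prod.lift y y') α e ≫ pullback.snd _ _ = α :=
      pullback.lift_snd _ _ _
    have w : k ≫ A.relMap = pullback.lift (prod.lift y y') α e ≫ pathSquareAct A P := by
      apply pullback.hom_ext
      · rw [Category.assoc, Category.assoc, relMap_fst, pathSquareAct_fst, comp_act, hk₁]
        exact act_congr _ (by rw [reassoc_of% e₁, prod.lift_fst]) e₂.symm h
      · rw [Category.assoc, Category.assoc, relMap_snd, pathSquareAct_snd, hk₂,
          reassoc_of% e₁, prod.lift_snd]
    have e₃ : pullback.lift k _ w ≫ pathRelMap A P = prod.lift y y' := by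
      rw [pathRelMap, pullback.lift_snd_assoc, e₁]
    exact ⟨pullback.lift k _ w, by rw [reassoc_of% e₃, prod.lift_fst],
      by rw [reassoc_of% e₃, prod.lift_snd]⟩
  · rintro ⟨k, rfl, rfl⟩
    have w := pullback.condition (f := A.relMap) (g := pathSquareAct A P)
    refine PathRel.precomp ?_ k
    rw [pathRelMap, Category.assoc, Category.assoc]
    refine ⟨pullback.snd _ _ ≫ pullback.snd _ _, ?_, pullback.fst _ _, ?_, ?_⟩
    · rw [Category.assoc, (pathSquare_w A P).1, Category.assoc]
    · rw [← comp_act _ _ _ _ (pathSquare_w A P).1, ← pathSquareAct_fst, ← relMap_fst,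
        reassoc_of% w]
    · rw [← pathSquareAct_snd, ← relMap_snd, reassoc_of% w]

/-- Unlike for `FibreRel`, no condition on fibres is needed: the representing fibration lies over Y
× Y, not over the fibre product. -/
theorem PathRel.of_weakEquivalence {D Z : C} (w : D ⟶ Z) [WeakEquivalence w]
    {y y' : Z ⟶ A.total} (h : PathRel A P D (w ≫ y) (w ≫ y')) : PathRel A P Z y y' := by
  rw [pathRel_iff] at *
  exact exists_lift_of_weakEquivalence _ w h

end Transport

end Hex

theorem HomotopyEqRel.Rel.of_weakEquivalence {Y : C} {R : HomotopyEqRel Y} {D Z : C} (w : D ⟶ Z)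
    [WeakEquivalence w] {a b : Z ⟶ Y} (h : R.Rel (w ≫ a) (w ≫ b)) : R.Rel a b := by
  obtain ⟨k, h₁, h₂⟩ := h
  have := R.fibration
  obtain ⟨l, h₁, h₂⟩ := exists_lift_of_weakEquivalence (prod.lift R.p₁ R.p₂) w (a := a) (b := b)
    ⟨k, by rwa [prod.lift_fst], by rwa [prod.lift_snd]⟩
  rw [prod.lift_fst] at h₁
  rw [prod.lift_snd] at h₂
  exact ⟨l, h₁, h₂⟩

theorem HomotopyEqRel.Rel.of_eq {Y : C} {R : HomotopyEqRel Y} {Z : C} {a b : Z ⟶ Y}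
    (h : a = b) : R.Rel a b := h ▸ .refl a

namespace Hex

/-! ### The left adjoint: gluing the fibres -/

section LeftAdjoint

variable {X : C} {A B : Hex (FibOver X)} {P : PathObject X} [P.IsGood]

/-- Path induction on α: for a constant path, transport is trivial. -/
theorem pathRel_act_symm {Z : C} (y : Z ⟶ A.total) (α : Z ⟶ P.P)
    (h : y ≫ A.proj = α ≫ P.p₀) : PathRel A P Z (act (transport A P) y α h) y := by
  have c : (pullback.fst (y ≫ A.proj) P.p₀ ≫ y) ≫ A.proj = pullback.snd _ _ ≫ P.p₀ := by
    rw [Category.assoc, pullback.condition]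
  have key : PathRel A P _ (act (transport A P) _ _ c) (pullback.fst (y ≫ A.proj) P.p₀ ≫ y) := by
    refine PathRel.of_weakEquivalence (constPath (y ≫ A.proj)) ?_
    rw [comp_act]
    refine FibreRel.pathRel ((isTransport A P).act_const _ _ ?_).symm
    rw [constPath_snd, reassoc_of% constPath_fst, Category.assoc]
  have c₀ : 𝟙 Z ≫ y ≫ A.proj = α ≫ P.p₀ := by rw [Category.id_comp, h]
  have e₁ : pullback.lift _ _ c₀ ≫ pullback.fst _ _ ≫ y = y := by
    rw [pullback.lift_fst_assoc, Category.id_comp]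
  have := key.precomp (pullback.lift _ _ c₀)
  rwa [e₁, comp_act, act_congr _ e₁ (pullback.lift_snd _ _ _)] at this

/-- Path induction on β alone, with α held fixed: for constant β the second transport is trivial and
α itself is the witness. -/
theorem pathRel_act_act {Z : C} (y : Z ⟶ A.total) (α β : Z ⟶ P.P)
    (h : y ≫ A.proj = α ≫ P.p₀) (h' : act (transport A P) y α h ≫ A.proj = β ≫ P.p₀) :
    PathRel A P Z y (act (transport A P) (act (transport A P) y α h) β h') := by
  set z := act (transport A P) y α h with hz
  have c : (pullback.fst (z ≫ A.proj) P.p₀ ≫ z) ≫ A.proj = pullback.snd _ _ ≫ P.p₀ := by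
    rw [Category.assoc, pullback.condition]
  have key : PathRel A P _ (pullback.fst (z ≫ A.proj) P.p₀ ≫ y) (act (transport A P) _ _ c) := by
    refine PathRel.of_weakEquivalence (constPath (z ≫ A.proj)) ?_
    rw [comp_act]
    refine PathRel.trans_fibreRel (y' := z) ?_ (.trans ?_
      ((isTransport A P).act_const _ _ ?_))
    · rw [reassoc_of% constPath_fst]
      exact pathRel_act _ _ _
    · rw [reassoc_of% constPath_fst]
      exact .refl _
    · rw [constPath_snd, reassoc_of% constPath_fst, Category.assoc]
  have c₀ : 𝟙 Z ≫ z ≫ A.proj = β ≫ P.p₀ := by rw [Category.id_comp, h']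
  have e₁ : ∀ x : Z ⟶ A.total, pullback.lift _ _ c₀ ≫ pullback.fst _ _ ≫ x = x := fun x => by
    rw [pullback.lift_fst_assoc, Category.id_comp]
  have := key.precomp (pullback.lift _ _ c₀)
  rwa [e₁, comp_act, act_congr _ (e₁ z) (pullback.lift_snd _ _ _)] at this

variable (A P) in
theorem pathRel_equivalence (Z : C) : _root_.Equivalence (PathRel A P Z) where
  refl y := (FibreRel.refl y).pathRel
  symm := by
    rintro y y' ⟨α, h, h'⟩
    exact h'.symm.trans_pathRel (pathRel_act_symm y α h)
  trans := by
    rintro y y' y'' ⟨α, h, h'⟩ ⟨β, k, k'⟩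
    have e := h'.proj_eq.trans k
    exact (pathRel_act_act y α β h e).trans_fibreRel
      (((isTransport A P).act_rel h' β e k).trans k')

variable (A P) in
/-- The total object of an object of `Hex(C(X))`, with the relation `PathRel`. -/
noncomputable def pathTotal : Hex C :=
  ⟨A.total, .ofRel (pathRelMap A P) (PathRel A P) (pathRel_equivalence A P) pathRel_iff⟩

theorem rel_pathTotal_iff {Z : C} (y y' : Z ⟶ A.total) :
    (pathTotal A P).rel.Rel y y' ↔ PathRel A P Z y y' :=
  HomotopyEqRel.rel_ofRel (pathRelMap A P) (pathRel_equivalence A P) pathRel_iff y y'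

/-- A map which respects the fibrewise relation also respects `PathRel`. -/
theorem PathRel.rel_comp {D : Hex C} {k : A.total ⟶ D.carrier}
    (hk : ∀ {Z : C} {a b : Z ⟶ A.total}, A.FibreRel a b → D.rel.Rel (a ≫ k) (b ≫ k))
    {Z : C} {y y' : Z ⟶ A.total} (hy : PathRel A P Z y y') : D.rel.Rel (y ≫ k) (y' ≫ k) := by
  obtain ⟨α, h, h'⟩ := hy
  -- It remains to relate the images of y and Γ(y, α), again by path induction.
  refine .trans ?_ (hk h')
  have c : (pullback.fst (y ≫ A.proj) P.p₀ ≫ y) ≫ A.proj = pullback.snd _ _ ≫ P.p₀ := by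
    rw [Category.assoc, pullback.condition]
  have key : D.rel.Rel ((pullback.fst (y ≫ A.proj) P.p₀ ≫ y) ≫ k)
      (act (transport A P) _ _ c ≫ k) := by
    refine HomotopyEqRel.Rel.of_weakEquivalence (constPath (y ≫ A.proj)) ?_
    rw [← Category.assoc, ← Category.assoc _ _ k, comp_act]
    refine hk ((isTransport A P).act_const _ _ ?_)
    rw [constPath_snd, reassoc_of% constPath_fst, Category.assoc]
  have c₀ : 𝟙 Z ≫ y ≫ A.proj = α ≫ P.p₀ := by rw [Category.id_comp, h]
  have e₁ : pullback.lift _ _ c₀ ≫ pullback.fst _ _ ≫ y = y := by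
    rw [pullback.lift_fst_assoc, Category.id_comp]
  have := key.precomp (pullback.lift _ _ c₀)
  rwa [← Category.assoc, e₁, ← Category.assoc _ _ k, comp_act,
    act_congr _ e₁ (pullback.lift_snd _ _ _)] at this

/-- A map out of the total object is tracked as soon as it respects the fibrewise relation. -/
theorem tracked_pathTotal {D : Hex C} (k : A.total ⟶ D.carrier)
    (hk : ∀ {Z : C} {a b : Z ⟶ A.total}, A.FibreRel a b → D.rel.Rel (a ≫ k) (b ≫ k)) :
    Tracked (pathTotal A P) D k :=
  (tracked_iff (A := pathTotal A P) k).2 fun h => ((rel_pathTotal_iff _ _).1 h).rel_comp hk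

/-- The action of `pathTotal` on morphisms. -/
noncomputable def pathTotalMap (φ : A ⟶ B) : pathTotal A P ⟶ pathTotal B P :=
  Quotient.map (sa := homSetoid A B) (sb := homSetoid (pathTotal A P) (pathTotal B P))
    (fun f => ⟨f.1.hom.left, tracked_pathTotal (D := pathTotal B P) f.1.hom.left
      fun h => (rel_pathTotal_iff _ _).2 (f.2.fibreRel h).pathRel⟩)
    (fun _ _ h => (rel_pathTotal_iff _ _).2 ((rel_iff _ _).1 h).pathRel) φ

variable (A P) in
theorem tracked_proj : Tracked (pathTotal A P) (i P) A.proj :=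
  tracked_pathTotal (D := i P) A.proj fun h => .of_eq h.proj_eq

variable (X P) in
/-- The left adjoint `Hex(C(X)) ⥤ Hex(C)/i(X)`. -/
noncomputable def toOver : Hex (FibOver X) ⥤ Over (i P) where
  obj A := Over.mk (homOf (A := pathTotal A P) (B := i P) A.proj (tracked_proj A P))
  map {A B} φ := Over.homMk (pathTotalMap φ) (by
    obtain ⟨f, hf, rfl⟩ := exists_homOf φ
    exact homOf_eq_iff.2 (.of_eq (FibOver.left_w f)))
  map_id A := rfl
  map_comp {A B D} φ ψ := by
    obtain ⟨f, hf, rfl⟩ := exists_homOf φ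
    obtain ⟨g, hg, rfl⟩ := exists_homOf ψ
    rfl

end LeftAdjoint

/-! ### The right adjoint: homotopy fibres -/

section RightAdjoint

variable {X : C}

section

variable (D : Hex C) {V : C} (t : V ⟶ X) (p : V ⟶ D.carrier)

/-- The restriction of a relation along a map `p`, to the fibres of a map `t`. -/
def PullbackRel (Z : C) (a b : Z ⟶ V) : Prop :=
  a ≫ t = b ≫ t ∧ D.rel.Rel (a ≫ p) (b ≫ p)

theorem pullbackRel_equivalence (Z : C) : _root_.Equivalence (PullbackRel D t p Z) where
  refl _ := ⟨rfl, .refl _⟩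
  symm h := ⟨h.1.symm, h.2.symm⟩
  trans h h' := ⟨h.1.trans h'.1, h.2.trans h'.2⟩

instance : Fibration (prod.lift D.rel.p₁ D.rel.p₂) := D.rel.fibration

variable [Fibration t]

/-- The fibration representing `PullbackRel`. -/
noncomputable def pullbackRelMap :
    pullback (prod.lift D.rel.p₁ D.rel.p₂)
      (prod.lift (pullback.fst t t ≫ p) (pullback.snd t t ≫ p)) ⟶ pullback t t :=
  pullback.snd _ _

instance : Fibration (pullbackRelMap D t p) := by unfold pullbackRelMap; infer_instance

theorem pullbackRel_iff {Z : C} (a b : Z ⟶ V) :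
    PullbackRel D t p Z a b ↔ ∃ k, k ≫ pullbackRelMap D t p ≫ pullback.fst _ _ = a ∧
      k ≫ pullbackRelMap D t p ≫ pullback.snd _ _ = b := by
  unfold pullbackRelMap
  constructor
  · rintro ⟨e, k, h₁, h₂⟩
    refine ⟨pullback.lift k (pullback.lift a b e) ?_, ?_, ?_⟩
    · apply Limits.prod.hom_ext
      · rw [Category.assoc, Category.assoc, prod.lift_fst, prod.lift_fst, h₁,
          pullback.lift_fst_assoc]
      · rw [Category.assoc, Category.assoc, prod.lift_snd, prod.lift_snd, h₂,
          pullback.lift_snd_assoc]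
    · rw [pullback.lift_snd_assoc, pullback.lift_fst]
    · rw [pullback.lift_snd_assoc, pullback.lift_snd]
  · rintro ⟨k, rfl, rfl⟩
    have c := pullback.condition (f := prod.lift D.rel.p₁ D.rel.p₂)
        (g := prod.lift (pullback.fst t t ≫ p) (pullback.snd t t ≫ p))
    have c₁ := congr(k ≫ $c ≫ prod.fst)
    have c₂ := congr(k ≫ $c ≫ prod.snd)
    rw [Category.assoc, Category.assoc, prod.lift_fst, prod.lift_fst] at c₁
    rw [Category.assoc, Category.assoc, prod.lift_snd, prod.lift_snd] at c₂
    refine ⟨?_, k ≫ pullback.fst _ _, ?_, ?_⟩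
    · rw [Category.assoc, Category.assoc, pullback.condition, Category.assoc, Category.assoc]
    · rw [Category.assoc, c₁, Category.assoc, Category.assoc]
    · rw [Category.assoc, c₂, Category.assoc, Category.assoc]

/-- The object of `Hex(C(X))` given by restricting a relation to the fibres of a fibration. -/
noncomputable def fibrewise : Hex (FibOver X) :=
  ⟨FibOver.mk t inferInstance, (FibOver.mk t inferInstance).homotopyEqRelOfRel
    (hasq := inferInstanceAs (Fibration (pullbackRelMap D t p))) (pullbackRelMap D t p)
    (PullbackRel D t p) (pullbackRel_equivalence D t p) (pullbackRel_iff D t p)⟩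

theorem fibreRel_fibrewise_iff {Z : C} (a b : Z ⟶ V) :
    FibreRel (fibrewise D t p) a b ↔ PullbackRel D t p Z a b :=
  (pullbackRel_iff D t p a b).symm

end

variable {P : PathObject X} [P.IsGood] (D : Hex C) (h : D.carrier ⟶ X)

/-- The map (d, α) ↦ (d, t α) is a pullback of the path fibration along h × 1, and projections from
products are fibrations. -/
instance fibration_target {W : C} (h : W ⟶ X) : Fibration (pullback.snd h P.p₀ ≫ P.p₁) := by
  let q : pullback h P.p₀ ⟶ W ⨯ X :=
    prod.lift (pullback.fst h P.p₀) (pullback.snd h P.p₀ ≫ P.p₁)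
  have q₁ : q ≫ prod.fst = pullback.fst h P.p₀ := prod.lift_fst _ _
  have q₂ : q ≫ prod.snd = pullback.snd h P.p₀ ≫ P.p₁ := prod.lift_snd _ _
  have fac : pullback.snd h P.p₀ ≫ P.p = q ≫ prod.map h (𝟙 X) := by
    ext
    · simp [reassoc_of% q₁, pullback.condition]
    · simp [q₂]
  have sq : IsPullback (q ≫ prod.fst) (pullback.snd h P.p₀) h (P.p ≫ prod.fst) := by
    simpa [q₁] using IsPullback.of_hasPullback h P.p₀
  have hq : Fibration q :=
    fibration_of_isPullback
      (IsPullback.of_right sq fac.symm (IsPullback.of_prod_fst_with_id h X)).flip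
      inferInstance
  rw [← q₂]
  infer_instance

variable (P) in
/-- The object of `Hex(C(X))` associated to an object of `Hex(C)` with a map to `X`. -/
noncomputable def pathPullback : Hex (FibOver X) :=
  fibrewise D (pullback.snd h P.p₀ ≫ P.p₁) (pullback.fst h P.p₀)

variable {D h}

theorem fibreRel_pathPullback_iff {Z : C} (a b : Z ⟶ pullback h P.p₀) :
    FibreRel (pathPullback P D h) a b ↔
      a ≫ pullback.snd h P.p₀ ≫ P.p₁ = b ≫ pullback.snd h P.p₀ ≫ P.p₁ ∧
        D.rel.Rel (a ≫ pullback.fst h P.p₀) (b ≫ pullback.fst h P.p₀) :=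
  fibreRel_fibrewise_iff _ _ _ _ _

end RightAdjoint

variable {X : C} {P : PathObject X} [P.IsGood]

/-! ### The counit, and stability of the image -/

section Counit

variable {D : Hex C} {h : D.carrier ⟶ X}

variable (P D h) in
theorem tracked_fst : Tracked (pathTotal (pathPullback P D h) P) D (pullback.fst h P.p₀) :=
  tracked_pathTotal (A := pathPullback P D h) _ fun h' => ((fibreRel_pathPullback_iff _ _).1 h').2

-- The path component is itself the witness. Thus the first projection is a morphism over i(X),
-- although the triangle need not commute in C.
variable (P) in
theorem rel_fst {W : C} (h : W ⟶ X) : (HomotopyEqRel.ofPathObject P).Rel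
    (pullback.fst h P.p₀ ≫ h) (pullback.snd h P.p₀ ≫ P.p₁) :=
  ⟨pullback.snd h P.p₀, (pullback.condition (f := h) (g := P.p₀)).symm, rfl⟩

/-- Two elements of the total object of `pathPullback` are related along paths as soon as their
images in `D` are related. -/
theorem pathRel_pathPullback_iff (hh : Tracked D (i P) h) {Z : C}
    (a b : Z ⟶ pullback h P.p₀) :
    PathRel (pathPullback P D h) P Z a b ↔
      D.rel.Rel (a ≫ pullback.fst h P.p₀) (b ≫ pullback.fst h P.p₀) := by
  have hfst : ∀ {W : C} {y y' : W ⟶ (pathPullback P D h).total},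
      PathRel (pathPullback P D h) P W y y' →
        D.rel.Rel (y ≫ pullback.fst h P.p₀) (y' ≫ pullback.fst h P.p₀) := fun h' =>
    h'.rel_comp fun h'' => ((fibreRel_pathPullback_iff _ _).1 h'').2
  refine ⟨hfst, fun hab => ?_⟩
  have h₁ : (HomotopyEqRel.ofPathObject P).Rel ((a ≫ pullback.fst h P.p₀) ≫ h)
      ((b ≫ pullback.fst h P.p₀) ≫ h) := hh.rel hab
  rw [Category.assoc, Category.assoc] at h₁
  -- The path β joins the points of X under a and b: back along the path component of a, along the
  -- path obtained by tracking h, and forward along the path component of b.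
  obtain ⟨β, hβ₁, hβ₂⟩ :=
    ((rel_fst P h).precomp a).symm.trans (h₁.trans ((rel_fst P h).precomp b))
  refine ⟨β, hβ₁.symm, (fibreRel_pathPullback_iff _ _).2 ⟨?_, ?_⟩⟩
  · exact ((isTransport _ P).act_proj _ _ _).trans hβ₂
  · exact (hfst (pathRel_act a β hβ₁.symm)).symm.trans hab

/-- The section equips each element of D with a constant path; reflection of the relation is
`pathRel_pathPullback_iff`. -/
theorem isIso_fst (hh : Tracked D (i P) h) : IsIso (homOf _ (tracked_fst P D h)) := by
  refine isIso_homOf _ (fun h' => ?_) (constPath (P := P) h) ?_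
  · exact (rel_pathTotal_iff _ _).2 ((pathRel_pathPullback_iff hh _ _).2 h')
  · exact .of_eq (constPath_fst h)

/-- A loop preserves the point of X, and transport preserves the component in D up to relation; the
fibrewise relation sees nothing else. -/
theorem isStable_pathPullback : IsStable P (pathPullback P D h) := by
  refine ⟨transport _ P, isTransport _ P, fun {Z} y α h₀ h₁ => ?_⟩
  refine (fibreRel_pathPullback_iff _ _).2 ⟨?_, ?_⟩
  · exact ((isTransport _ P).act_proj y α h₀).trans h₁.symm
  · have : PathRel (pathPullback P D h) P Z y (pullback.lift y α h₀ ≫ transport _ P) :=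
      pathRel_act y α h₀
    exact (this.rel_comp fun h' => ((fibreRel_pathPullback_iff _ _).1 h').2).symm

end Counit

/-! ### The adjunction -/

section Adjunction

variable (B : Over (i P))

/-- A representative of the structure map of an object over `i(X)`. -/
noncomputable def overMap : B.left.carrier ⟶ X :=
  (exists_homOf (A := B.left) (B := i P) B.hom).choose

theorem tracked_overMap : Tracked B.left (i P) (overMap B) :=
  (exists_homOf (A := B.left) (B := i P) B.hom).choose_spec.choose

theorem homOf_overMap : homOf _ (tracked_overMap B) = B.hom :=
  (exists_homOf (A := B.left) (B := i P) B.hom).choose_spec.choose_spec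

/-- The object of `Hex(C(X))` associated to an object over `i(X)`. -/
noncomputable abbrev ofOver : Hex (FibOver X) := pathPullback P B.left (overMap B)

/-- The universal map to an object over `i(X)`. -/
noncomputable def fromOfOver : (toOver X P).obj (ofOver B) ⟶ B :=
  Over.homMk (homOf _ (tracked_fst P B.left (overMap B))) (by
    rw [← homOf_overMap]
    exact homOf_eq_iff.2 (rel_fst P (overMap B)))

instance : IsIso (fromOfOver B) := by
  have : IsIso ((Over.forget _).map (fromOfOver B)) := isIso_fst (tracked_overMap B)
  exact isIso_of_reflects_iso _ (Over.forget _)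

/-- Injectivity holds because the relation on the codomain ignores the path component. Surjectivity
pairs a representative with a path witnessing that it lives over i(X). -/
theorem bijective_comp_fromOfOver (A : Hex (FibOver X)) :
    Function.Bijective (fun φ : A ⟶ ofOver B => (toOver X P).map φ ≫ fromOfOver B) := by
  constructor
  · intro φ ψ e
    obtain ⟨f, hf, rfl⟩ := exists_homOf φ
    obtain ⟨g, hg, rfl⟩ := exists_homOf ψ
    have e' := homOf_eq_iff.1 congr(($e).left)
    refine homOf_eq_iff.2 ((rel_iff f g).2 ((fibreRel_pathPullback_iff _ _).2 ⟨?_, e'⟩))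
    exact (FibOver.left_w f).trans (FibOver.left_w g).symm
  · intro ψ
    obtain ⟨k, hk, e⟩ := exists_homOf (A := pathTotal A P) ψ.left
    have w : homOf k hk ≫ homOf _ (tracked_overMap B) =
        homOf (A := pathTotal A P) (B := i P) A.proj (tracked_proj A P) := by
      rw [e, homOf_overMap]
      exact Over.w ψ
    -- Equality of morphisms into i(X) is a homotopy; this path from h k to f becomes the second
    -- component of the lift.
    obtain ⟨α, h₁, h₂⟩ := homOf_eq_iff.1 w
    let l : A.total ⟶ pullback (overMap B) P.p₀ := pullback.lift k α h₁.symm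
    have hl₁ : l ≫ pullback.fst _ _ = k := pullback.lift_fst _ _ _
    have hl₂ : l ≫ pullback.snd _ _ = α := pullback.lift_snd _ _ _
    let g : A.carrier ⟶ (ofOver B).carrier := FibOver.homMk l (by
      refine Eq.trans ?_ h₂
      change l ≫ pullback.snd _ _ ≫ P.p₁ = _
      rw [reassoc_of% hl₂]
      rfl)
    have hg : Tracked A (ofOver B) g := (tracked_iff g).2 fun {Z a b} hab => by
      refine (rel_iff _ _).2 ((fibreRel_pathPullback_iff _ _).2 ⟨?_, ?_⟩)
      · exact (FibOver.left_w (a ≫ g)).trans (FibOver.left_w (b ≫ g)).symm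
      · have := hk.rel ((rel_pathTotal_iff _ _).2 ((rel_iff a b).1 hab).pathRel)
        change B.left.rel.Rel ((a.hom.left ≫ l) ≫ pullback.fst _ _)
          ((b.hom.left ≫ l) ≫ pullback.fst _ _)
        rwa [Category.assoc, Category.assoc, hl₁]
    refine ⟨homOf g hg, Over.OverMorphism.ext (Eq.trans ?_ e)⟩
    exact homOf_eq_iff.2 (.of_eq hl₁)

/-- The bijection on morphisms of the adjunction. -/
noncomputable def homEquivOfOver (A : Hex (FibOver X)) (B : Over (i P)) :
    ((toOver X P).obj A ⟶ B) ≃ (A ⟶ ofOver B) :=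
  (Equiv.ofBijective _ (bijective_comp_fromOfOver B A)).symm

theorem homEquivOfOver_symm_apply {A : Hex (FibOver X)} {B : Over (i P)} (φ : A ⟶ ofOver B) :
    (homEquivOfOver A B).symm φ = (toOver X P).map φ ≫ fromOfOver B := rfl

theorem homEquivOfOver_naturality (A' A : Hex (FibOver X)) (B : Over (i P)) (φ : A' ⟶ A)
    (g : (toOver X P).obj A ⟶ B) :
    homEquivOfOver A' B ((toOver X P).map φ ≫ g) = φ ≫ homEquivOfOver A B g := by
  apply (homEquivOfOver A' B).symm.injective
  rw [Equiv.symm_apply_apply, homEquivOfOver_symm_apply, Functor.map_comp, Category.assoc,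
    ← homEquivOfOver_symm_apply, Equiv.symm_apply_apply]

variable (X P) in
/-- The right adjoint `Hex(C)/i(X) ⥤ Hex(C(X))`. -/
noncomputable def ofOverFunctor : Over (i P) ⥤ Hex (FibOver X) :=
  Adjunction.rightAdjointOfEquiv homEquivOfOver homEquivOfOver_naturality

variable (X P) in
/-- The adjunction between `Hex(C(X))` and `Hex(C)/i(X)`. -/
noncomputable def toOverAdjunction : toOver X P ⊣ ofOverFunctor X P :=
  Adjunction.adjunctionOfEquivRight homEquivOfOver homEquivOfOver_naturality

instance : IsIso (toOverAdjunction X P).counit := by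
  have (B : Over (i P)) : IsIso ((toOverAdjunction X P).counit.app B) := by
    have e : (toOverAdjunction X P).counit.app B = fromOfOver B :=
      (Adjunction.adjunctionOfEquivRight_counit_app _ homEquivOfOver_naturality B).trans
        ((homEquivOfOver_symm_apply _).trans (by
          rw [CategoryTheory.Functor.map_id, Category.id_comp]))
    rw [e]
    exact inferInstanceAs (IsIso (fromOfOver B))
  exact NatIso.isIso_of_isIso_app _

instance : (ofOverFunctor X P).Full := (toOverAdjunction X P).fullyFaithfulROfIsIsoCounit.full

instance : (ofOverFunctor X P).Faithful :=
  (toOverAdjunction X P).fullyFaithfulROfIsIsoCounit.faithful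

end Adjunction

/-! ### Stable objects as the essential image -/

section Stable

variable {A : Hex (FibOver X)}

theorem IsStable.fibreRel_act (hA : IsStable P A) {Z : C} (y : Z ⟶ A.total) (α : Z ⟶ P.P)
    (h₀ : y ≫ A.proj = α ≫ P.p₀) (h₁ : y ≫ A.proj = α ≫ P.p₁) :
    A.FibreRel (act (transport A P) y α h₀) y := by
  obtain ⟨Γ, hΓ, h⟩ := hA
  exact ((isTransport A P).act_unique hΓ y α h₀).trans (h y α h₀ h₁)

/-- If y and y' lie over the same point, the path relating them is a loop, which acts trivially. -/
theorem IsStable.fibreRel_of_pathRel (hA : IsStable P A) {Z : C} {y y' : Z ⟶ A.total}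
    (h : PathRel A P Z y y') (e : y ≫ A.proj = y' ≫ A.proj) : A.FibreRel y y' := by
  obtain ⟨α, h₀, h'⟩ := h
  refine (hA.fibreRel_act y α h₀ ?_).symm.trans h'
  rw [e, ← h'.proj_eq, (isTransport A P).act_proj]

theorem fibreRel_pathPullback_pathTotal_iff {h : A.total ⟶ X} {Z : C}
    (a b : Z ⟶ pullback h P.p₀) : FibreRel (pathPullback P (pathTotal A P) h) a b ↔
      a ≫ pullback.snd h P.p₀ ≫ P.p₁ = b ≫ pullback.snd h P.p₀ ≫ P.p₁ ∧
        PathRel A P Z (a ≫ pullback.fst h P.p₀) (b ≫ pullback.fst h P.p₀) :=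
  (fibreRel_pathPullback_iff a b).trans (and_congr_right fun _ => rel_pathTotal_iff _ _)

/-- This is applied to the unit. The map h is only a chosen representative of the class of f, so
`hr` asks for a homotopy rather than an equality; `hl₁` is a triangle identity. -/
theorem IsStable.isIso_homOf (hA : IsStable P A) {h : A.total ⟶ X}
    (hr : (HomotopyEqRel.ofPathObject P).Rel A.proj h)
    {f : A.carrier ⟶ (pathPullback P (pathTotal A P) h).carrier}
    (hf : Tracked A (pathPullback P (pathTotal A P) h) f) (l : A.total ⟶ pullback h P.p₀)
    (hl : f.hom.left = l) (hl₁ : PathRel A P _ (l ≫ pullback.fst h P.p₀) (𝟙 A.total)) :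
    IsIso (homOf f hf) := by
  have key : ∀ {Z : C} (z : Z ⟶ A.total), PathRel A P Z
      ((z ≫ l) ≫ pullback.fst h P.p₀) z := fun z => by
    have := hl₁.precomp z
    rwa [Category.comp_id, ← Category.assoc] at this
  have hlp : l ≫ pullback.snd h P.p₀ ≫ P.p₁ = A.proj := by
    rw [← hl]
    exact FibOver.left_w f
  -- The inverse sends (y, α) to the transport of y along γ, which runs from f y to h y and on along
  -- α.
  obtain ⟨γ, hγ₀, hγ₁⟩ := (hr.precomp (pullback.fst h P.p₀)).trans (rel_fst P h)
  let a : pullback h P.p₀ ⟶ A.total :=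
    act (transport A P) (pullback.fst h P.p₀) γ hγ₀.symm
  have ha : a ≫ A.proj = pullback.snd h P.p₀ ≫ P.p₁ :=
    ((isTransport A P).act_proj _ _ _).trans hγ₁
  have hE (Z : C) := pathRel_equivalence A P Z
  refine Hex.isIso_homOf hf (fun {Z y y'} h' => ?_) (FibOver.homMk a ha) ?_
  · have h₀ : FibreRel (pathPullback P (pathTotal A P) h) (y.hom.left ≫ f.hom.left)
        (y'.hom.left ≫ f.hom.left) := (rel_iff _ _).1 h'
    rw [hl] at h₀
    obtain ⟨-, h₂⟩ := (fibreRel_pathPullback_pathTotal_iff _ _).1 h₀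
    refine (rel_iff _ _).2 (hA.fibreRel_of_pathRel ?_ ?_)
    · exact (hE _).trans ((hE _).symm (key y.hom.left)) ((hE _).trans h₂ (key y'.hom.left))
    · exact (FibOver.left_w y).trans (FibOver.left_w y').symm
  · refine (rel_iff _ _).2 ?_
    change FibreRel (pathPullback P (pathTotal A P) h) (a ≫ f.hom.left) (𝟙 (pullback h P.p₀))
    rw [hl]
    have e₁ : (a ≫ l) ≫ pullback.snd h P.p₀ ≫ P.p₁ =
        𝟙 (pullback h P.p₀) ≫ pullback.snd h P.p₀ ≫ P.p₁ := by
      rw [Category.assoc, hlp, ha, Category.id_comp]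
    have e₂ : PathRel A P _ ((a ≫ l) ≫ pullback.fst h P.p₀)
        (𝟙 (pullback h P.p₀) ≫ pullback.fst h P.p₀) := by
      rw [Category.id_comp]
      exact (hE _).trans (key a) ((hE _).symm (pathRel_act _ _ _))
    exact (fibreRel_pathPullback_pathTotal_iff _ _).2 ⟨e₁, e₂⟩

/-- Stable objects are in the image of the right adjoint. -/
theorem IsStable.exists_iso (hA : IsStable P A) :
    ∃ B : Over (i P), Nonempty (A ≅ ofOver B) := by
  let B := (toOver X P).obj A
  have hB : homOf _ (tracked_overMap B) =
      homOf (A := pathTotal A P) (B := i P) A.proj (tracked_proj A P) := homOf_overMap B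
  obtain ⟨f, hf, e⟩ := exists_homOf (homEquivOfOver A B (𝟙 B))
  -- The triangle identity: the first component of the unit is path-related to the identity of Y.
  have e' : (toOver X P).map (homOf f hf) ≫ fromOfOver B = 𝟙 B := by
    rw [e, ← homEquivOfOver_symm_apply, Equiv.symm_apply_apply]
  have := hA.isIso_homOf (h := overMap B) (homOf_eq_iff.1 hB).symm hf f.hom.left rfl
    ((rel_pathTotal_iff _ _).1 (homOf_eq_iff.1 congr(($e').left)))
  exact ⟨B, ⟨@asIso _ _ _ _ (homOf f hf) this⟩⟩

variable (X P) in
/-- The right adjoint as a functor to the stable objects. -/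
noncomputable def toStable : Over (i P) ⥤ (IsStable P).FullSubcategory :=
  (IsStable P).lift (ofOverFunctor X P) fun _ => isStable_pathPullback

instance : (toStable X P).Full :=
  Functor.Full.of_comp_faithful_iso
    ((IsStable P).liftCompιIso (ofOverFunctor X P) fun _ => isStable_pathPullback)

instance : (toStable X P).Faithful :=
  Functor.Faithful.of_comp_iso
    ((IsStable P).liftCompιIso (ofOverFunctor X P) fun _ => isStable_pathPullback)

instance : (toStable X P).EssSurj where
  mem_essImage A := by
    obtain ⟨B, ⟨e⟩⟩ := A.property.exists_iso
    exact ⟨B, ⟨(IsStable P).isoMk e.symm⟩⟩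

instance : (toStable X P).IsEquivalence where

end Stable

end Hex

end PathCategory

theorem mainTheorem8 {C : Type u} [Category.{v} C] [CategoryWithFibrations C]
    [CategoryWithWeakEquivalences C] [PathCategory C] (X : C) (P : PathObject X) [P.IsGood] :
    ∃ e : Over (PathCategory.Hex.i P) ≌ (PathCategory.Hex.IsStable P).FullSubcategory,
      Nonempty (Reflective (e.functor ⋙ (PathCategory.Hex.IsStable P).ι)) :=
  ⟨(PathCategory.Hex.toStable X P).asEquivalence, ⟨{
    -- The composite with the inclusion unfolds to `ofOverFunctor`, so its properties and adjunction
    -- transfer definitionally.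
    toFull := inferInstanceAs (PathCategory.Hex.ofOverFunctor X P).Full
    toFaithful := inferInstanceAs (PathCategory.Hex.ofOverFunctor X P).Faithful
    L := PathCategory.Hex.toOver X P
    adj := PathCategory.Hex.toOverAdjunction X P }⟩⟩
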